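/- Let $d\ge 1$, let $\Omega\subset\mathbb R^d$ be open, and write $x=(x_1,x')\in\mathbb R\times\mathbb R^{d-1}$. All function spaces without further specification consist of complex valued functions; $\|\cdot\|$ is the norm of $L^2(\Omega)$. **Coefficients.** Let $a\in L^2_{\rm loc}(\Omega;\mathbb R)$ and $q\in L^1_{\rm loc}(\Omega;\mathbb R)$ with $a,q\ge 0$. Let ${\rm Dom}(m)=\{\psi\in L^2(\Omega): m\psi\in L^2(\Omega)\}$ for a measurable function $m$, and let $-\Delta+q$ be the Dirichlet realization in $L^2(\Omega)$, $${\rm Dom}(-\Delta+q)=\{\psi\in W^{1,2}_0(\Omega)\cap{\rm Dom}(q^{1/2}) : (-\Delta+q)\psi\in L^2(\Omega)\}.$$ Suppose that $a=a_{\rm r}+a_{\rm s}$ with $0\le a_{\rm r}\in W^{1,\infty}_{\rm loc}(\overline\Omega;\mathbb R)$, $a_{\rm s}\in L^2_{\rm loc}(\Omega;\mathbb R)$, such that for every $\varepsilon>0$ there are constants $M_\nabla,M_{\rm s}>0$ with $$|\nabla a_{\rm r}|\le \varepsilon a_{\rm r}^{3/2}+M_\nabla(q^{1/2}+1)\quad\text{a.e.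 in }\Omega,$$ $$\|a_{\rm s}\psi\|\le\varepsilon\big(\|(-\Delta+q)\psi\|+\|a_{\rm r}\psi\|\big)+M_{\rm s}\|\psi\|,\qquad \psi\in{\rm Dom}(a_{\rm r})\cap{\rm Dom}(-\Delta+q).$$ Assume in addition that $q\in L^2_{\rm loc}(\Omega)$. **The operator $G$.** Let $\mathcal W(\Omega)$ be the completion of $C_0^\infty(\Omega)$ with respect to the inner product $\langle\nabla\cdot,\nabla\cdot\rangle+\langle q^{1/2}\cdot,q^{1/2}\cdot\rangle$ (which contains $W_0^{1,2}(\Omega)\cap{\rm Dom}(q^{1/2})$), let $\mathcal H=\mathcal W(\Omega)\oplus L^2(\Omega)$, and let $G=\overline{G_0}$ be the closure in $\mathcal H$ of $$G_0(\phi_1,\phi_2)=\big(\phi_2,\,-(-\Delta+q)\phi_1-2a\phi_2\big),\qquad {\rm Dom}(G_0)=\big({\rm Dom}(-\Delta+q)\cap{\rm Dom}(a)\big)^2 .$$ For a linear operator $T$ in a Hilbert space, $\sigma_{e2}(T)$ denotes the set of all $\mu\in\mathbb C$ for which there is a sequence $(\psi_n)\subset{\rm Dom}(T)$ with $\|\psi_n\|=1$,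 $\psi_n\to 0$ weakly and $(T-\mu)\psi_n\to 0$. **Theorem.** Let $\lambda\in(-\infty,0)$. Let $\omega:(0,\infty)\to(0,\infty)$ and suppose that $\Omega$ contains $$U_\omega=\{(x_1,x')\in\mathbb R^d: x_1>0,\ |x'|<\omega(x_1)^{-1}\}$$ (for $d=1$ this is just $(0,\infty)$ and $\omega$ plays no role). Suppose that i) $q(x)+2\lambda a(x)+\lambda^2=-A(x_1)+B(x)$ for (almost every) $x\in U_\omega$, where $B$ is real valued, $A\in C^1((0,\infty);\mathbb R)$, $$\lim_{u\to+\infty}A(u)=+\infty,\qquad \lim_{u\to+\infty}\frac{|A'(u)|}{A(u)}=0,\qquad \lim_{n\to\infty}\ \operatorname*{ess\,sup}_{x\in U_\omega,\ |x|>n}\ \frac{|B(x)|^2}{A(x_1)}=0;$$ ii) if $d>1$, then $\omega\in C^2((0,\infty))$ and, as $u\to+\infty$, $$\frac{\omega'(u)}{\omega(u)}=o(1),\qquad \frac{\omega''(u)}{\omega(u)^3}=O(1),\qquad \frac{\omega(u)^4}{A(u)}=o(1).$$ Then $\lambda\in\sigma_{e2}(G)$. -/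

import Mathlib

open MeasureTheory Filter Topology TopologicalSpace
open scoped Distributions ENNReal

namespace DampedWave

noncomputable section

/-! ### Test functions, `L²` spaces, the Sobolev space `W₀^{1,2}(Ω)` -/

/-- The partial derivative `∂ᵢ η`. -/
def pderiv {d : ℕ} {F : Type*} [NormedAddCommGroup F] [NormedSpace ℝ F] (i : Fin d)
    (η : EuclideanSpace ℝ (Fin d) → F) (x : EuclideanSpace ℝ (Fin d)) : F :=
  fderiv ℝ η x (EuclideanSpace.single i 1)

/-- The (complex) gradient `∇ η` of a complex valued function on `ℝᵈ`. -/
def gradC {d : ℕ} (η : EuclideanSpace ℝ (Fin d) → ℂ) (x : EuclideanSpace ℝ (Fin d)) :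
    EuclideanSpace ℂ (Fin d) :=
  WithLp.toLp 2 fun i => pderiv i η x

/-- `L²(Ω)`, complex valued. -/
abbrev L2 {d : ℕ} (Ω : Opens (EuclideanSpace ℝ (Fin d))) : Type :=
  Lp ℂ 2 (volume.restrict (Ω : Set (EuclideanSpace ℝ (Fin d))))

/-- `L²(Ω; ℂᵈ)`. -/
abbrev L2vec {d : ℕ} (Ω : Opens (EuclideanSpace ℝ (Fin d))) : Type :=
  Lp (EuclideanSpace ℂ (Fin d)) 2 (volume.restrict (Ω : Set (EuclideanSpace ℝ (Fin d))))

theorem pderiv_add {d : ℕ} {Ω : Opens (EuclideanSpace ℝ (Fin d))} (i : Fin d) (η ζ : 𝓓(Ω, ℂ))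
    (x : EuclideanSpace ℝ (Fin d)) :
    pderiv i (⇑(η + ζ)) x = pderiv i (⇑η) x + pderiv i (⇑ζ) x := by
  have h1 : DifferentiableAt ℝ (⇑η) x := (η.contDiff.differentiable (by simp)) x
  have h2 : DifferentiableAt ℝ (⇑ζ) x := (ζ.contDiff.differentiable (by simp)) x
  have : (⇑(η + ζ) : EuclideanSpace ℝ (Fin d) → ℂ) = ⇑η + ⇑ζ := rfl
  rw [pderiv, this, fderiv_add h1 h2]
  rfl

theorem pderiv_smul {d : ℕ} {Ω : Opens (EuclideanSpace ℝ (Fin d))} (i : Fin d) (c : ℂ)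
    (η : 𝓓(Ω, ℂ)) (x : EuclideanSpace ℝ (Fin d)) :
    pderiv i (⇑(c • η)) x = c * pderiv i (⇑η) x := by
  have h1 : DifferentiableAt ℝ (⇑η) x := (η.contDiff.differentiable (by simp)) x
  have : (⇑(c • η) : EuclideanSpace ℝ (Fin d) → ℂ) = c • ⇑η := rfl
  rw [pderiv, this, fderiv_const_smul h1]
  rfl

theorem gradC_add {d : ℕ} {Ω : Opens (EuclideanSpace ℝ (Fin d))} (η ζ : 𝓓(Ω, ℂ))
    (x : EuclideanSpace ℝ (Fin d)) : gradC (⇑(η + ζ)) x = gradC (⇑η) x + gradC (⇑ζ) x := by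
  ext i; exact pderiv_add i η ζ x

theorem gradC_smul {d : ℕ} {Ω : Opens (EuclideanSpace ℝ (Fin d))} (c : ℂ) (η : 𝓓(Ω, ℂ))
    (x : EuclideanSpace ℝ (Fin d)) : gradC (⇑(c • η)) x = c • gradC (⇑η) x := by
  ext i; exact pderiv_smul i c η x

theorem gradC_zero {d : ℕ} {Ω : Opens (EuclideanSpace ℝ (Fin d))}
    (x : EuclideanSpace ℝ (Fin d)) : gradC (⇑(0 : 𝓓(Ω, ℂ))) x = 0 := by
  have : (0 : 𝓓(Ω, ℂ)) = (0 : ℂ) • (0 : 𝓓(Ω, ℂ)) := by simp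
  rw [this, gradC_smul, zero_smul]

/-- The pairs `(η, ∇η)` with `η ∈ C₀^∞(Ω)`, as elements of `L²(Ω) × L²(Ω; ℂᵈ)`. -/
def testPairs {d : ℕ} (Ω : Opens (EuclideanSpace ℝ (Fin d))) : Submodule ℂ (L2 Ω × L2vec Ω) where
  carrier := {p | ∃ η : 𝓓(Ω, ℂ),
    p.1 =ᵐ[volume.restrict (Ω : Set (EuclideanSpace ℝ (Fin d)))] (⇑η) ∧
    p.2 =ᵐ[volume.restrict (Ω : Set (EuclideanSpace ℝ (Fin d)))] gradC (⇑η)}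
  zero_mem' := by
    refine ⟨0, ?_, ?_⟩
    · filter_upwards [Lp.coeFn_zero ℂ 2 (volume.restrict (Ω : Set (EuclideanSpace ℝ (Fin d))))]
        with x hx
      simpa using hx
    · filter_upwards [Lp.coeFn_zero (EuclideanSpace ℂ (Fin d)) 2
        (volume.restrict (Ω : Set (EuclideanSpace ℝ (Fin d))))] with x hx
      rw [gradC_zero]; simpa using hx
  add_mem' := by
    rintro p p' ⟨η, h1, h2⟩ ⟨ζ, h3, h4⟩
    refine ⟨η + ζ, ?_, ?_⟩
    · filter_upwards [Lp.coeFn_add p.1 p'.1, h1, h3] with x hx e1 e3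
      change (p.1 + p'.1) x = _
      rw [hx, Pi.add_apply, e1, e3]; rfl
    · filter_upwards [Lp.coeFn_add p.2 p'.2, h2, h4] with x hx e1 e3
      change (p.2 + p'.2) x = _
      rw [hx, Pi.add_apply, e1, e3, gradC_add]
  smul_mem' := by
    rintro c p ⟨η, h1, h2⟩
    refine ⟨c • η, ?_, ?_⟩
    · filter_upwards [Lp.coeFn_smul c p.1, h1] with x hx e1
      change (c • p.1) x = _
      rw [hx, Pi.smul_apply, e1]; rfl
    · filter_upwards [Lp.coeFn_smul c p.2, h2] with x hx e1
      change (c • p.2) x = _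
      rw [hx, Pi.smul_apply, e1, gradC_smul]

/-- The Sobolev space `W₀^{1,2}(Ω)`, the closure of `C₀^∞(Ω)` in the `W^{1,2}` norm, given as the
space of all pairs `(φ, ∇φ)`. -/
def sobolevZero {d : ℕ} (Ω : Opens (EuclideanSpace ℝ (Fin d))) : Submodule ℂ (L2 Ω × L2vec Ω) :=
  (testPairs Ω).topologicalClosure

/-! ### Multiplication operators and the Dirichlet realization of `-Δ + q` -/

/-- The maximal domain `{φ ∈ L²(Ω) : m φ ∈ L²(Ω)}` of the operator of multiplication by a real
function `m`. -/
def mulDom {d : ℕ} (Ω : Opens (EuclideanSpace ℝ (Fin d))) (m : EuclideanSpace ℝ (Fin d) → ℝ) :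
    Submodule ℂ (L2 Ω) where
  carrier := {φ | MemLp (fun x => (m x : ℂ) * φ x) 2
    (volume.restrict (Ω : Set (EuclideanSpace ℝ (Fin d))))}
  zero_mem' := by
    refine (MemLp.zero' (p := 2) (μ := volume.restrict
      (Ω : Set (EuclideanSpace ℝ (Fin d)))) (ε := ℂ)).ae_eq ?_
    filter_upwards [Lp.coeFn_zero ℂ 2 (volume.restrict (Ω : Set (EuclideanSpace ℝ (Fin d))))]
      with x hx
    rw [hx]; simp
  add_mem' := by
    intro φ ψ hφ hψ
    refine (MemLp.add hφ hψ).ae_eq ?_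
    filter_upwards [Lp.coeFn_add φ ψ] with x hx
    simp only [Pi.add_apply, hx]; ring
  smul_mem' := by
    intro c φ hφ
    have h : MemLp (fun x => c * ((m x : ℂ) * φ x)) 2
        (volume.restrict (Ω : Set (EuclideanSpace ℝ (Fin d)))) := MemLp.const_mul hφ c
    refine h.ae_eq ?_
    filter_upwards [Lp.coeFn_smul c φ] with x hx
    simp only [Pi.smul_apply, hx, smul_eq_mul]; ring

/-- The operator of multiplication by a real function `m` in `L²(Ω)` on its maximal domain. -/
def mulOp {d : ℕ} (Ω : Opens (EuclideanSpace ℝ (Fin d))) (m : EuclideanSpace ℝ (Fin d) → ℝ) :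
    L2 Ω →ₗ.[ℂ] L2 Ω where
  domain := mulDom Ω m
  toFun :=
    { toFun := fun φ => MemLp.toLp (fun x => (m x : ℂ) * (φ : L2 Ω) x) φ.2
      map_add' := by
        intro φ ψ
        refine Lp.ext ?_
        filter_upwards [Lp.coeFn_add (φ : L2 Ω) (ψ : L2 Ω),
          Lp.coeFn_add (MemLp.toLp (fun x => (m x : ℂ) * (φ : L2 Ω) x) φ.2)
            (MemLp.toLp (fun x => (m x : ℂ) * (ψ : L2 Ω) x) ψ.2),
          MemLp.coeFn_toLp φ.2, MemLp.coeFn_toLp ψ.2, MemLp.coeFn_toLp (φ + ψ).2]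
          with x h1 h2 h3 h4 h5
        rw [h2, h5, Pi.add_apply, h3, h4, Submodule.coe_add, h1, Pi.add_apply, mul_add]
      map_smul' := by
        intro c φ
        refine Lp.ext ?_
        filter_upwards [Lp.coeFn_smul c (φ : L2 Ω),
          Lp.coeFn_smul c (MemLp.toLp (fun x => (m x : ℂ) * (φ : L2 Ω) x) φ.2),
          MemLp.coeFn_toLp φ.2, MemLp.coeFn_toLp (c • φ).2]
          with x h1 h2 h3 h4
        rw [RingHom.id_apply, h2, h4, Pi.smul_apply, h3, Submodule.coe_smul, h1, Pi.smul_apply,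
          smul_eq_mul, smul_eq_mul]
        ring }

/-- `q φ` (for a real function `q` and `φ ∈ L²(Ω)`) defines a distribution on `Ω`. -/
def IsDistr {d : ℕ} (Ω : Opens (EuclideanSpace ℝ (Fin d))) (q : EuclideanSpace ℝ (Fin d) → ℝ)
    (φ : L2 Ω) : Prop :=
  ∀ η : 𝓓(Ω, ℂ), Integrable (fun x => (q x : ℂ) * φ x * η x)
    (volume.restrict (Ω : Set (EuclideanSpace ℝ (Fin d))))

theorem integrable_l2_mul {d : ℕ} {Ω : Opens (EuclideanSpace ℝ (Fin d))} (f : L2 Ω)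
    {h : EuclideanSpace ℝ (Fin d) → ℂ} (hc : Continuous h) (hs : HasCompactSupport h) :
    Integrable (fun x => f x * h x) (volume.restrict (Ω : Set (EuclideanSpace ℝ (Fin d)))) :=
  (Lp.memLp f).integrable_mul (q := 2) ((hc.memLp_of_hasCompactSupport hs).restrict _)

theorem continuous_pderiv {d : ℕ} {Ω : Opens (EuclideanSpace ℝ (Fin d))} (i : Fin d)
    (η : 𝓓(Ω, ℂ)) : Continuous (pderiv i (⇑η)) :=
  (η.contDiff.continuous_fderiv (by simp)).clm_apply continuous_const

theorem hasCompactSupport_pderiv {d : ℕ} {Ω : Opens (EuclideanSpace ℝ (Fin d))} (i : Fin d)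
    (η : 𝓓(Ω, ℂ)) : HasCompactSupport (pderiv i (⇑η)) :=
  η.hasCompactSupport.fderiv_apply ℝ _

theorem memLp_coord {d : ℕ} {Ω : Opens (EuclideanSpace ℝ (Fin d))} (g : L2vec Ω) (i : Fin d) :
    MemLp (fun x => g x i) 2 (volume.restrict (Ω : Set (EuclideanSpace ℝ (Fin d)))) :=
  (EuclideanSpace.proj (𝕜 := ℂ) i).comp_memLp' (Lp.memLp g)

theorem integrable_grad_mul {d : ℕ} {Ω : Opens (EuclideanSpace ℝ (Fin d))} (g : L2vec Ω)
    (η : 𝓓(Ω, ℂ)) : Integrable (fun x => ∑ i, g x i * pderiv i (⇑η) x)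
      (volume.restrict (Ω : Set (EuclideanSpace ℝ (Fin d)))) := by
  refine integrable_finsetSum _ fun i _ => ?_
  exact (memLp_coord g i).integrable_mul (q := 2)
    (((continuous_pderiv i η).memLp_of_hasCompactSupport (hasCompactSupport_pderiv i η)).restrict _)

/-- The graph of the Dirichlet realization of `-Δ + q` in `L²(Ω)`: all `(φ, f)` such that
`φ ∈ W₀^{1,2}(Ω)`, `q^{1/2} φ ∈ L²(Ω)` and `(-Δ + q) φ = f ∈ L²(Ω)` in the sense of distributions,
i.e. `∫ ∇φ · ∇η + q φ η = ∫ f η` for all `η ∈ C₀^∞(Ω)`. (For `0 ≤ q ∈ L¹_loc(Ω)`, that `q φ` is a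
distribution follows from `q^{1/2} φ ∈ L²(Ω)`.) -/
def schrodingerGraph {d : ℕ} (Ω : Opens (EuclideanSpace ℝ (Fin d)))
    (q : EuclideanSpace ℝ (Fin d) → ℝ) : Submodule ℂ (L2 Ω × L2 Ω) where
  carrier := {p | ∃ g : L2vec Ω, (p.1, g) ∈ sobolevZero Ω ∧
    p.1 ∈ mulDom Ω (fun x => √(q x)) ∧ IsDistr Ω q p.1 ∧
    ∀ η : 𝓓(Ω, ℂ),
      ∫ x in (Ω : Set (EuclideanSpace ℝ (Fin d))),
          ((∑ i, g x i * pderiv i (⇑η) x) + (q x : ℂ) * p.1 x * η x) =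
        ∫ x in (Ω : Set (EuclideanSpace ℝ (Fin d))), p.2 x * η x}
  zero_mem' := by
    have z1 := Lp.coeFn_zero ℂ 2 (volume.restrict (Ω : Set (EuclideanSpace ℝ (Fin d))))
    have z2 := Lp.coeFn_zero (EuclideanSpace ℂ (Fin d)) 2
      (volume.restrict (Ω : Set (EuclideanSpace ℝ (Fin d))))
    refine ⟨0, zero_mem _, zero_mem _, fun η => ?_, fun η => integral_congr_ae ?_⟩
    · refine (integrable_zero (EuclideanSpace ℝ (Fin d)) ℂ _).congr ?_
      filter_upwards [z1] with x hx
      rw [Prod.fst_zero, hx]; simp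
    · filter_upwards [z1, z2] with x hx hx2
      simp only [Prod.fst_zero, Prod.snd_zero, hx, hx2]; simp
  add_mem' := by
    rintro ⟨φ, f⟩ ⟨φ', f'⟩ ⟨g, h1, h2, h3, h4⟩ ⟨g', h1', h2', h3', h4'⟩
    have zφ := Lp.coeFn_add φ φ'
    have zf := Lp.coeFn_add f f'
    have zg := Lp.coeFn_add g g'
    have hd : IsDistr Ω q (φ + φ') := by
      intro η
      refine ((h3 η).add (h3' η)).congr ?_
      filter_upwards [zφ] with x hx
      simp only [Pi.add_apply, hx]; ring
    refine ⟨g + g', add_mem h1 h1', add_mem h2 h2', hd, fun η => ?_⟩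
    have i1 : Integrable (fun x => (∑ i, g x i * pderiv i (⇑η) x) + (q x : ℂ) * φ x * η x)
        (volume.restrict (Ω : Set (EuclideanSpace ℝ (Fin d)))) :=
      (integrable_grad_mul g η).add (h3 η)
    have i1' : Integrable (fun x => (∑ i, g' x i * pderiv i (⇑η) x) + (q x : ℂ) * φ' x * η x)
        (volume.restrict (Ω : Set (EuclideanSpace ℝ (Fin d)))) :=
      (integrable_grad_mul g' η).add (h3' η)
    have e1 : ∫ x in (Ω : Set (EuclideanSpace ℝ (Fin d))),
        ((∑ i, (g + g' : L2vec Ω) x i * pderiv i (⇑η) x) + (q x : ℂ) * (φ + φ' : L2 Ω) x * η x) =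
        (∫ x in (Ω : Set (EuclideanSpace ℝ (Fin d))),
          ((∑ i, g x i * pderiv i (⇑η) x) + (q x : ℂ) * φ x * η x)) +
        ∫ x in (Ω : Set (EuclideanSpace ℝ (Fin d))),
          ((∑ i, g' x i * pderiv i (⇑η) x) + (q x : ℂ) * φ' x * η x) := by
      rw [← integral_add i1 i1']
      refine integral_congr_ae ?_
      filter_upwards [zφ, zg] with x hx hx2
      simp only [hx, hx2, Pi.add_apply, PiLp.add_apply, add_mul, Finset.sum_add_distrib]
      ring
    have e2 : ∫ x in (Ω : Set (EuclideanSpace ℝ (Fin d))), (f + f' : L2 Ω) x * η x =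
        (∫ x in (Ω : Set (EuclideanSpace ℝ (Fin d))), f x * η x) +
        ∫ x in (Ω : Set (EuclideanSpace ℝ (Fin d))), f' x * η x := by
      rw [← integral_add (integrable_l2_mul f η.continuous η.hasCompactSupport)
        (integrable_l2_mul f' η.continuous η.hasCompactSupport)]
      refine integral_congr_ae ?_
      filter_upwards [zf] with x hx
      simp only [hx, Pi.add_apply, add_mul]
    exact e1.trans ((congrArg₂ (· + ·) (h4 η) (h4' η)).trans e2.symm)
  smul_mem' := by
    rintro c ⟨φ, f⟩ ⟨g, h1, h2, h3, h4⟩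
    have zφ := Lp.coeFn_smul c φ
    have zf := Lp.coeFn_smul c f
    have zg := Lp.coeFn_smul c g
    have hd : IsDistr Ω q (c • φ) := by
      intro η
      refine ((h3 η).smul c).congr ?_
      filter_upwards [zφ] with x hx
      simp only [Pi.smul_apply, hx, smul_eq_mul]; ring
    refine ⟨c • g, Submodule.smul_mem _ c h1, Submodule.smul_mem _ c h2, hd, fun η => ?_⟩
    have e1 : ∫ x in (Ω : Set (EuclideanSpace ℝ (Fin d))),
        ((∑ i, (c • g : L2vec Ω) x i * pderiv i (⇑η) x) + (q x : ℂ) * (c • φ : L2 Ω) x * η x) =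
        c * ∫ x in (Ω : Set (EuclideanSpace ℝ (Fin d))),
          ((∑ i, g x i * pderiv i (⇑η) x) + (q x : ℂ) * φ x * η x) := by
      rw [← integral_const_mul]
      refine integral_congr_ae ?_
      filter_upwards [zφ, zg] with x hx hx2
      simp only [hx, hx2, Pi.smul_apply, PiLp.smul_apply, smul_eq_mul, mul_add, Finset.mul_sum]
      congr 1
      · exact Finset.sum_congr rfl fun i _ => by ring
      · ring
    have e2 : ∫ x in (Ω : Set (EuclideanSpace ℝ (Fin d))), (c • f : L2 Ω) x * η x =
        c * ∫ x in (Ω : Set (EuclideanSpace ℝ (Fin d))), f x * η x := by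
      rw [← integral_const_mul]
      refine integral_congr_ae ?_
      filter_upwards [zf] with x hx
      simp only [hx, Pi.smul_apply, smul_eq_mul, mul_assoc]
    exact e1.trans ((congrArg (c * ·) (h4 η)).trans e2.symm)

/-! ### Uniqueness: the graphs below are graphs of operators -/

theorem continuous_pairing {d : ℕ} {Ω : Opens (EuclideanSpace ℝ (Fin d))} {F : Type*}
    [NormedAddCommGroup F] [InnerProductSpace ℂ F] {h : EuclideanSpace ℝ (Fin d) → F}
    (hh : MemLp h 2 (volume.restrict (Ω : Set (EuclideanSpace ℝ (Fin d))))) :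
    Continuous fun f : Lp F 2 (volume.restrict (Ω : Set (EuclideanSpace ℝ (Fin d)))) =>
      ∫ x in (Ω : Set (EuclideanSpace ℝ (Fin d))), inner ℂ (h x) (f x) := by
  have : (fun f : Lp F 2 (volume.restrict (Ω : Set (EuclideanSpace ℝ (Fin d)))) =>
      ∫ x in (Ω : Set (EuclideanSpace ℝ (Fin d))), inner ℂ (h x) (f x)) =
      fun f => inner ℂ (hh.toLp h) f := by
    funext f
    rw [L2.inner_def]
    refine integral_congr_ae ?_
    filter_upwards [hh.coeFn_toLp] with x hx
    rw [hx]
  rw [this]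
  fun_prop

/-- An element of `W₀^{1,2}(Ω)` has its second component as weak gradient. -/
theorem sobolevZero_weak {d : ℕ} {Ω : Opens (EuclideanSpace ℝ (Fin d))} {p : L2 Ω × L2vec Ω}
    (hp : p ∈ sobolevZero Ω) (η : 𝓓(Ω, ℂ)) (i : Fin d) :
    ∫ x in (Ω : Set (EuclideanSpace ℝ (Fin d))), p.1 x * pderiv i (⇑η) x =
      -∫ x in (Ω : Set (EuclideanSpace ℝ (Fin d))), p.2 x i * η x := by
  have m1 : MemLp (fun x => starRingEnd ℂ (pderiv i (⇑η) x)) 2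
      (volume.restrict (Ω : Set (EuclideanSpace ℝ (Fin d)))) :=
    (((continuous_pderiv i η).memLp_of_hasCompactSupport
      (hasCompactSupport_pderiv i η)).restrict _).star
  have m2 : MemLp (fun x => EuclideanSpace.single i (starRingEnd ℂ (η x))) 2
      (volume.restrict (Ω : Set (EuclideanSpace ℝ (Fin d)))) := by
    have : MemLp (fun x => starRingEnd ℂ (η x)) 2
      (volume.restrict (Ω : Set (EuclideanSpace ℝ (Fin d)))) :=
      ((η.continuous.memLp_of_hasCompactSupport η.hasCompactSupport).restrict _).star
    refine MemLp.of_le this ?_ (ae_of_all _ fun x => by simp)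
    have hc : Continuous (fun x => EuclideanSpace.single i (starRingEnd ℂ (η x))) := by
      refine (PiLp.continuous_toLp 2 _).comp ?_
      exact continuous_pi fun j => by
        by_cases hj : j = i
        · subst hj
          simp only [Pi.single_eq_same]
          exact Complex.continuous_conj.comp η.continuous
        · simpa only [Pi.single_eq_of_ne hj] using continuous_const
    exact hc.aestronglyMeasurable
  have c1 := (continuous_pairing m1).comp
    (continuous_fst : Continuous (Prod.fst : L2 Ω × L2vec Ω → L2 Ω))
  have c2 := (continuous_pairing m2).comp
    (continuous_snd : Continuous (Prod.snd : L2 Ω × L2vec Ω → L2vec Ω))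
  have key : closure (testPairs Ω : Set (L2 Ω × L2vec Ω)) ⊆
      {p | (∫ x in (Ω : Set (EuclideanSpace ℝ (Fin d))),
          inner ℂ (starRingEnd ℂ (pderiv i (⇑η) x)) (p.1 x)) =
        -∫ x in (Ω : Set (EuclideanSpace ℝ (Fin d))),
          inner ℂ (EuclideanSpace.single i (starRingEnd ℂ (η x))) (p.2 x)} := by
    refine closure_minimal ?_ (isClosed_eq c1 c2.neg)
    rintro ⟨f, g⟩ ⟨ζ, h1, h2⟩
    have e1 : ∫ x in (Ω : Set (EuclideanSpace ℝ (Fin d))),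
        inner ℂ (starRingEnd ℂ (pderiv i (⇑η) x)) (f x) = ∫ x, ζ x * pderiv i (⇑η) x := by
      rw [← setIntegral_eq_integral_of_forall_compl_eq_zero
        (s := (Ω : Set (EuclideanSpace ℝ (Fin d)))) (f := fun x => ζ x * pderiv i (⇑η) x)]
      · refine integral_congr_ae ?_
        filter_upwards [h1] with x hx
        rw [hx]; simp
      · intro x hx
        rw [image_eq_zero_of_notMem_tsupport fun h => hx (ζ.tsupport_subset h), zero_mul]
    have e2 : ∫ x in (Ω : Set (EuclideanSpace ℝ (Fin d))),
        inner ℂ (EuclideanSpace.single i (starRingEnd ℂ (η x))) (g x) =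
        ∫ x, pderiv i (⇑ζ) x * η x := by
      rw [← setIntegral_eq_integral_of_forall_compl_eq_zero
        (s := (Ω : Set (EuclideanSpace ℝ (Fin d)))) (f := fun x => pderiv i (⇑ζ) x * η x)]
      · refine integral_congr_ae ?_
        filter_upwards [h2] with x hx
        rw [hx, EuclideanSpace.inner_single_left]; simp [gradC, mul_comm]
      · intro x hx
        rw [image_eq_zero_of_notMem_tsupport fun h => hx (η.tsupport_subset h), mul_zero]
    refine (e1.trans ?_).trans (congrArg Neg.neg e2.symm)
    refine integral_mul_fderiv_eq_neg_fderiv_mul_of_integrable ?_ ?_ ?_ ?_ ?_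
    · exact ((continuous_pderiv i ζ).mul η.continuous).integrable_of_hasCompactSupport
        (η.hasCompactSupport.mul_left)
    · exact (ζ.continuous.mul (continuous_pderiv i η)).integrable_of_hasCompactSupport
        (ζ.hasCompactSupport.mul_right)
    · exact (ζ.continuous.mul η.continuous).integrable_of_hasCompactSupport
        (ζ.hasCompactSupport.mul_right)
    · exact fun x _ => (ζ.contDiff.differentiable (by simp)) x
    · exact fun x _ => (η.contDiff.differentiable (by simp)) x
  have h : (∫ x in (Ω : Set (EuclideanSpace ℝ (Fin d))),
      inner ℂ (starRingEnd ℂ (pderiv i (⇑η) x)) (p.1 x)) =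
      -∫ x in (Ω : Set (EuclideanSpace ℝ (Fin d))),
        inner ℂ (EuclideanSpace.single i (starRingEnd ℂ (η x))) (p.2 x) := key hp
  have e3 : ∀ x, inner ℂ (starRingEnd ℂ (pderiv i (⇑η) x)) (p.1 x) = p.1 x * pderiv i (⇑η) x :=
    fun x => by simp
  have e4 : ∀ x, inner ℂ (EuclideanSpace.single i (starRingEnd ℂ (η x))) (p.2 x) =
    p.2 x i * η x := fun x => by
    rw [EuclideanSpace.inner_single_left]; simp [mul_comm]
  simpa only [e3, e4] using h

/-- A function in `L²(Ω)` that annihilates all test functions vanishes. -/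
theorem ae_zero_of_test {d : ℕ} {Ω : Opens (EuclideanSpace ℝ (Fin d))}
    {f : EuclideanSpace ℝ (Fin d) → ℂ}
    (hf : MemLp f 2 (volume.restrict (Ω : Set (EuclideanSpace ℝ (Fin d)))))
    (h : ∀ η : 𝓓(Ω, ℂ), ∫ x in (Ω : Set (EuclideanSpace ℝ (Fin d))), f x * η x = 0) :
    f =ᵐ[volume.restrict (Ω : Set (EuclideanSpace ℝ (Fin d)))] 0 := by
  have hl : LocallyIntegrableOn f (Ω : Set (EuclideanSpace ℝ (Fin d))) volume := by
    refine (locallyIntegrableOn_iff Ω.isOpen.isLocallyClosed).2 fun K hK hKc => ?_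
    have hm : MemLp f 2 (volume.restrict K) := by
      have := hf.restrict K
      rwa [Measure.restrict_restrict hKc.measurableSet, Set.inter_eq_left.2 hK] at this
    have : IsFiniteMeasure (volume.restrict K) := ⟨by
      rw [Measure.restrict_apply_univ]; exact hKc.measure_lt_top⟩
    exact hm.integrable (by norm_num)
  have := Ω.isOpen.ae_eq_zero_of_integral_contDiff_smul_eq_zero hl (fun g hg hgc hgs => ?_)
  · exact (ae_restrict_iff' Ω.isOpen.measurableSet).2 this
  · let η : 𝓓(Ω, ℂ) := ⟨fun x => (g x : ℂ), Complex.ofRealCLM.contDiff.comp hg,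
      hgc.comp_left (g := fun r : ℝ => (r : ℂ)) (by simp),
      (closure_mono (Function.support_comp_subset (g := fun r : ℝ => (r : ℂ)) (by simp) g)).trans
        hgs⟩
    rw [← setIntegral_eq_integral_of_forall_compl_eq_zero
        (s := (Ω : Set (EuclideanSpace ℝ (Fin d))))]
    · rw [← h η]
      refine integral_congr_ae (ae_of_all _ fun x => ?_)
      change (g x : ℝ) • f x = f x * (g x : ℂ)
      rw [Complex.real_smul, mul_comm]
    · intro x hx
      rw [image_eq_zero_of_notMem_tsupport fun h => hx (hgs h), zero_smul]

theorem sobolevZero_snd_eq_zero {d : ℕ} {Ω : Opens (EuclideanSpace ℝ (Fin d))} {g : L2vec Ω}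
    (hp : ((0 : L2 Ω), g) ∈ sobolevZero Ω) : g = 0 := by
  have h : ∀ i, (fun x => g x i) =ᵐ[volume.restrict (Ω : Set (EuclideanSpace ℝ (Fin d)))] 0 := by
    intro i
    refine ae_zero_of_test (memLp_coord g i) fun η => ?_
    have h1 := sobolevZero_weak hp η i
    have h2 : ∫ x in (Ω : Set (EuclideanSpace ℝ (Fin d))),
        (0 : L2 Ω) x * pderiv i (⇑η) x = 0 := by
      refine (integral_congr_ae ?_).trans (integral_zero (EuclideanSpace ℝ (Fin d)) ℂ)
      filter_upwards [Lp.coeFn_zero ℂ 2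
        (volume.restrict (Ω : Set (EuclideanSpace ℝ (Fin d))))] with x hx
      rw [hx]; simp
    rw [h2] at h1
    exact neg_eq_zero.1 h1.symm
  refine Lp.ext ?_
  filter_upwards [ae_all_iff.2 h, Lp.coeFn_zero (EuclideanSpace ℂ (Fin d)) 2
    (volume.restrict (Ω : Set (EuclideanSpace ℝ (Fin d))))] with x hx h0
  rw [h0]
  ext i
  exact hx i

theorem schrodingerGraph_single {d : ℕ} {Ω : Opens (EuclideanSpace ℝ (Fin d))}
    {q : EuclideanSpace ℝ (Fin d) → ℝ} (p : L2 Ω × L2 Ω) (hp : p ∈ schrodingerGraph Ω q)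
    (h0 : p.1 = 0) : p.2 = 0 := by
  obtain ⟨φ, f⟩ := p
  obtain ⟨g, h1, -, -, h4⟩ := hp
  simp only at h0 h1 h4 ⊢
  subst h0
  have hg := sobolevZero_snd_eq_zero h1
  subst hg
  refine Lp.ext ?_
  refine (ae_zero_of_test (Lp.memLp f) fun η => ?_).trans (Lp.coeFn_zero ℂ 2 _).symm
  rw [← h4 η]
  refine (integral_congr_ae ?_).trans (integral_zero (EuclideanSpace ℝ (Fin d)) ℂ)
  filter_upwards [Lp.coeFn_zero ℂ 2 (volume.restrict (Ω : Set (EuclideanSpace ℝ (Fin d)))),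
    Lp.coeFn_zero (EuclideanSpace ℂ (Fin d)) 2
    (volume.restrict (Ω : Set (EuclideanSpace ℝ (Fin d))))] with x hx hx2
  rw [hx, hx2]; simp

/-- The Dirichlet realization of `-Δ + q` as an operator in `L²(Ω)`. -/
def schrodinger {d : ℕ} (Ω : Opens (EuclideanSpace ℝ (Fin d)))
    (q : EuclideanSpace ℝ (Fin d) → ℝ) : L2 Ω →ₗ.[ℂ] L2 Ω :=
  (schrodingerGraph Ω q).toLinearPMap

theorem schrodinger_graph {d : ℕ} (Ω : Opens (EuclideanSpace ℝ (Fin d)))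
    (q : EuclideanSpace ℝ (Fin d) → ℝ) : (schrodinger Ω q).graph = schrodingerGraph Ω q :=
  Submodule.toLinearPMap_graph_eq _ schrodingerGraph_single

theorem integral_norm_mul_norm_le {d : ℕ} {Ω : Opens (EuclideanSpace ℝ (Fin d))}
    (f : L2 Ω) (g : L2vec Ω) :
    ∫ x in (Ω : Set (EuclideanSpace ℝ (Fin d))), ‖f x‖ * ‖g x‖ ≤ ‖f‖ * ‖g‖ := by
  have hf := (Lp.memLp f).norm
  have hg := (Lp.memLp g).norm
  have h := real_inner_le_norm (hg.toLp _) (hf.toLp _)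
  rw [L2.inner_def, Lp.norm_toLp, Lp.norm_toLp, eLpNorm_norm, eLpNorm_norm, mul_comm] at h
  refine le_trans (le_of_eq (integral_congr_ae ?_)) h
  filter_upwards [hf.coeFn_toLp, hg.coeFn_toLp] with x h1 h2
  rw [h1, h2]
  simp

/-- A weighted Poincaré inequality for test functions. -/
theorem weighted_poincare {d : ℕ} [NeZero d] {Ω : Opens (EuclideanSpace ℝ (Fin d))}
    (η : 𝓓(Ω, ℂ)) :
    ∫ x in (Ω : Set (EuclideanSpace ℝ (Fin d))), 1 / (1 + x 0 ^ 2) * ‖η x‖ ^ 2 ≤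
      Real.pi * ∫ x in (Ω : Set (EuclideanSpace ℝ (Fin d))), ‖η x‖ * ‖gradC (⇑η) x‖ := by
  have hη : ∀ x, HasFDerivAt (⇑η) (fderiv ℝ (⇑η) x) x := fun x =>
    ((η.contDiff.differentiable (by simp)) x).hasFDerivAt
  set F : EuclideanSpace ℝ (Fin d) → ℝ := fun x => ‖η x‖ ^ 2 with hF
  set h : EuclideanSpace ℝ (Fin d) → ℝ := fun x => Real.arctan (x 0) with hh
  have dF : ∀ x, HasFDerivAt F (2 • (innerSL ℝ (η x)).comp (fderiv ℝ (⇑η) x)) x := fun x =>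
    (hη x).norm_sq
  have dh : ∀ x, HasFDerivAt h ((1 / (1 + x 0 ^ 2)) •
      (EuclideanSpace.proj (𝕜 := ℝ) (0 : Fin d) : EuclideanSpace ℝ (Fin d) →L[ℝ] ℝ)) x :=
    fun x => ((EuclideanSpace.proj (𝕜 := ℝ) (0 : Fin d) :
      EuclideanSpace ℝ (Fin d) →L[ℝ] ℝ).hasFDerivAt (x := x)).arctan
  set e : EuclideanSpace ℝ (Fin d) := EuclideanSpace.single 0 1 with he
  have dhe : ∀ x, fderiv ℝ h x e = 1 / (1 + x 0 ^ 2) := fun x => by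
    rw [(dh x).fderiv]; simp [he]
  have dFe : ∀ x, fderiv ℝ F x e = 2 * inner ℝ (η x) (pderiv 0 (⇑η) x) := fun x => by
    rw [(dF x).fderiv]; simp [he, pderiv]; ring
  have cF : Continuous F := by have := η.continuous; fun_prop
  have ch : Continuous h := by fun_prop
  have cη := η.continuous
  have cp := continuous_pderiv 0 η
  have cw : Continuous (fun x : EuclideanSpace ℝ (Fin d) => 1 / (1 + x 0 ^ 2)) :=
    continuous_const.div (by fun_prop) fun x => by positivity
  have cdF : Continuous fun x => fderiv ℝ F x e := by
    simp only [dFe]; fun_prop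
  have cdh : Continuous fun x => fderiv ℝ h x e := by
    simp only [dhe]; exact cw
  have sF : HasCompactSupport F := by
    refine η.hasCompactSupport.mono' ((Function.support_subset_iff'.2 fun x hx => ?_))
    simp [hF, image_eq_zero_of_notMem_tsupport hx]
  have sdF : HasCompactSupport fun x => fderiv ℝ F x e := sF.fderiv_apply ℝ e
  have ibp : ∫ x, F x * fderiv ℝ h x e = -∫ x, fderiv ℝ F x e * h x :=
    integral_mul_fderiv_eq_neg_fderiv_mul_of_integrable
      ((cdF.mul ch).integrable_of_hasCompactSupport sdF.mul_right)
      ((cF.mul cdh).integrable_of_hasCompactSupport sF.mul_right)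
      ((cF.mul ch).integrable_of_hasCompactSupport sF.mul_right)
      (fun x _ => (dF x).differentiableAt) (fun x _ => (dh x).differentiableAt)
  have cg : Continuous (gradC (⇑η)) :=
    (PiLp.continuous_toLp 2 _).comp (continuous_pi fun i => continuous_pderiv i η)
  have hz : ∀ x, x ∉ (Ω : Set (EuclideanSpace ℝ (Fin d))) → η x = 0 := fun x hx =>
    image_eq_zero_of_notMem_tsupport fun hx' => hx (η.tsupport_subset hx')
  have sn : HasCompactSupport fun x => ‖η x‖ * ‖gradC (⇑η) x‖ :=
    (η.hasCompactSupport.norm).mul_right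
  rw [setIntegral_eq_integral_of_forall_compl_eq_zero (fun x hx => by simp [hz x hx]),
    setIntegral_eq_integral_of_forall_compl_eq_zero (fun x hx => by simp [hz x hx]),
    ← integral_const_mul]
  have e1 : ∫ x : EuclideanSpace ℝ (Fin d), 1 / (1 + x 0 ^ 2) * ‖η x‖ ^ 2 =
      ∫ x, -(fderiv ℝ F x e * h x) := by
    rw [integral_neg, ← ibp]
    refine integral_congr_ae (ae_of_all _ fun x => ?_)
    simp only [dhe, hF]; ring
  rw [e1]
  refine integral_mono ((cdF.mul ch).integrable_of_hasCompactSupport sdF.mul_right).neg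
    (((cη.norm.mul cg.norm).integrable_of_hasCompactSupport sn).const_mul _) fun x => ?_
  have b1 : |h x| ≤ Real.pi / 2 :=
    abs_le.2 ⟨(Real.neg_pi_div_two_lt_arctan _).le, (Real.arctan_lt_pi_div_two _).le⟩
  have b2 : |fderiv ℝ F x e| ≤ 2 * (‖η x‖ * ‖gradC (⇑η) x‖) := by
    rw [dFe, abs_mul, abs_two]
    have := abs_real_inner_le_norm (η x) (pderiv 0 (⇑η) x)
    have h2 : ‖pderiv 0 (⇑η) x‖ ≤ ‖gradC (⇑η) x‖ := PiLp.norm_apply_le (gradC (⇑η) x) 0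
    have := mul_le_mul_of_nonneg_left h2 (norm_nonneg (η x))
    linarith
  calc -(fderiv ℝ F x e * h x) ≤ |fderiv ℝ F x e * h x| := neg_le_abs _
    _ = |fderiv ℝ F x e| * |h x| := abs_mul _ _
    _ ≤ (2 * (‖η x‖ * ‖gradC (⇑η) x‖)) * (Real.pi / 2) :=
        mul_le_mul b2 b1 (abs_nonneg _) (by positivity)
    _ = Real.pi * (‖η x‖ * ‖gradC (⇑η) x‖) := by ring

/-- A function in `W₀^{1,2}(Ω)` with vanishing gradient vanishes (if `d ≥ 1`). -/
theorem sobolevZero_fst_eq_zero {d : ℕ} [NeZero d] {Ω : Opens (EuclideanSpace ℝ (Fin d))}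
    {φ : L2 Ω} (hp : (φ, (0 : L2vec Ω)) ∈ sobolevZero Ω) : φ = 0 := by
  set μ := volume.restrict (Ω : Set (EuclideanSpace ℝ (Fin d))) with hμ
  set w : EuclideanSpace ℝ (Fin d) → ℝ := fun x => 1 / (1 + x 0 ^ 2) with hw
  have hw0 : ∀ x, 0 < w x := fun x => by positivity
  have hw1 : ∀ x, w x ≤ 1 := fun x => by
    rw [hw]; simp only
    rw [div_le_one (by positivity)]; nlinarith [sq_nonneg (x 0)]
  have hwc : Continuous w :=
    continuous_const.div (by fun_prop) fun x => by positivity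
  have hwm : Measurable fun x => ENNReal.ofReal (w x) := hwc.measurable.ennreal_ofReal
  set ν := μ.withDensity (fun x => ENNReal.ofReal (w x)) with hν
  have hνμ : ν ≤ μ := by
    calc ν ≤ μ.withDensity 1 := withDensity_mono (ae_of_all _ fun x => by
            simpa using hw1 x)
      _ = μ := withDensity_one
  have habs : μ ≪ ν := withDensity_absolutelyContinuous' hwm.aemeasurable
    (ae_of_all _ fun x => by simpa using hw0 x)
  have test : ∀ p ∈ testPairs Ω, eLpNorm p.1 2 ν ^ 2 ≤ ENNReal.ofReal (Real.pi * (‖p.1‖ * ‖p.2‖)) := by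
    rintro ⟨f, g⟩ ⟨η, h1, h2⟩
    have e1 : eLpNorm f 2 ν ^ 2 = ENNReal.ofReal (∫ x, w x * ‖η x‖ ^ 2 ∂μ) := by
      rw [ofReal_integral_eq_lintegral_ofReal]
      · have := eLpNorm_nnreal_pow_eq_lintegral (f := f) (p := 2) (μ := ν) (by norm_num)
        simp only [NNReal.coe_ofNat, ENNReal.coe_ofNat, ENNReal.rpow_ofNat] at this
        rw [this, hν, lintegral_withDensity_eq_lintegral_mul₀ hwm.aemeasurable
          ((Lp.aestronglyMeasurable f).enorm.pow_const 2)]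
        refine lintegral_congr_ae ?_
        filter_upwards [h1] with x hx
        simp only [Pi.mul_apply]
        rw [hx, ENNReal.ofReal_mul (hw0 x).le, ENNReal.ofReal_pow (norm_nonneg _), ofReal_norm]
      · refine ((hwc.mul (η.continuous.norm.pow 2)).integrable_of_hasCompactSupport ?_).restrict
        refine η.hasCompactSupport.mono' ((Function.support_subset_iff'.2 fun x hx => ?_))
        simp [image_eq_zero_of_notMem_tsupport hx]
      · exact ae_of_all _ fun x => mul_nonneg (hw0 x).le (by positivity)
    change eLpNorm f 2 ν ^ 2 ≤ _
    rw [e1]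
    refine ENNReal.ofReal_le_ofReal ((weighted_poincare η).trans ?_)
    refine mul_le_mul_of_nonneg_left ?_ Real.pi_pos.le
    refine le_trans (le_of_eq (integral_congr_ae ?_)) (integral_norm_mul_norm_le f g)
    filter_upwards [h1, h2] with x hx hx2
    rw [← hx, ← hx2]
  obtain ⟨p, hpt, hlim⟩ := mem_closure_iff_seq_limit.1 (show _ ∈ closure _ from hp)
  have l1 : Tendsto (fun n => (p n).1) atTop (𝓝 φ) := (continuous_fst.tendsto _).comp hlim
  have l2 : Tendsto (fun n => (p n).2) atTop (𝓝 0) := (continuous_snd.tendsto _).comp hlim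
  have l3 : Tendsto (fun n => eLpNorm (p n).1 2 ν ^ 2) atTop (𝓝 0) := by
    refine tendsto_of_tendsto_of_tendsto_of_le_of_le tendsto_const_nhds ?_ (fun _ => zero_le)
      (fun n => test _ (hpt n))
    have := (l1.norm.mul l2.norm).const_mul Real.pi
    simpa using ENNReal.tendsto_ofReal this
  have l4 : Tendsto (fun n => eLpNorm (p n).1 2 ν) atTop (𝓝 0) := by
    have := ((ENNReal.continuous_rpow_const (y := (1 / 2 : ℝ))).tendsto 0).comp l3
    have e : ∀ a : ℝ≥0∞, (a ^ 2) ^ (1 / 2 : ℝ) = a := fun a => by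
      rw [← ENNReal.rpow_natCast, ← ENNReal.rpow_mul]; norm_num
    simp only [Function.comp_def, e] at this
    simpa using this
  have l5 : Tendsto (fun n => ENNReal.ofReal ‖φ - (p n).1‖) atTop (𝓝 0) := by
    have : Tendsto (fun n => ‖φ - (p n).1‖) atTop (𝓝 0) := by
      simpa using ((tendsto_const_nhds (x := φ)).sub l1).norm
    simpa using ENNReal.tendsto_ofReal this
  have h0 : eLpNorm φ 2 ν = 0 := by
    refine le_antisymm (ge_of_tendsto (by simpa using l5.add l4)
      (Eventually.of_forall fun n => ?_)) zero_le
    have mν : ∀ f : L2 Ω, AEStronglyMeasurable f ν := fun f =>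
      (Lp.aestronglyMeasurable f).mono_measure hνμ
    have e : (⇑φ : EuclideanSpace ℝ (Fin d) → ℂ) =ᵐ[ν] ⇑(φ - (p n).1) + ⇑(p n).1 := by
      refine (Measure.absolutelyContinuous_of_le hνμ).ae_le ?_
      filter_upwards [Lp.coeFn_sub φ (p n).1] with x hx
      rw [Pi.add_apply, hx, Pi.sub_apply, sub_add_cancel]
    have t1 : eLpNorm (⇑(φ - (p n).1)) 2 ν ≤ ENNReal.ofReal ‖φ - (p n).1‖ := by
      rw [Lp.norm_def, ENNReal.ofReal_toReal (Lp.eLpNorm_ne_top _)]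
      exact eLpNorm_mono_measure _ hνμ
    rw [eLpNorm_congr_ae e]
    refine (eLpNorm_add_le (mν _) (mν _) (by norm_num)).trans ?_
    simpa only [ofReal_norm] using add_le_add_left t1 _
  rw [eLpNorm_eq_zero_iff ((Lp.aestronglyMeasurable φ).mono_measure hνμ) (by norm_num)] at h0
  have h1 : (⇑φ : EuclideanSpace ℝ (Fin d) → ℂ) =ᵐ[μ] 0 := habs.ae_le h0
  exact Lp.ext (h1.trans (Lp.coeFn_zero ℂ 2 _).symm)

/-! ### The energy space and the generator `G` -/

/-- The pairs `(∇η, q^{1/2} η)` with `η ∈ C₀^∞(Ω)`, as elements of the Hilbert space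
`L²(Ω; ℂᵈ) ⊕ L²(Ω)`. -/
def testEnergy {d : ℕ} (Ω : Opens (EuclideanSpace ℝ (Fin d)))
    (q : EuclideanSpace ℝ (Fin d) → ℝ) : Submodule ℂ (WithLp 2 (L2vec Ω × L2 Ω)) where
  carrier := {p | ∃ η : 𝓓(Ω, ℂ),
    p.fst =ᵐ[volume.restrict (Ω : Set (EuclideanSpace ℝ (Fin d)))] gradC (⇑η) ∧
    p.snd =ᵐ[volume.restrict (Ω : Set (EuclideanSpace ℝ (Fin d)))]
      fun x => ((√(q x) : ℝ) : ℂ) * η x}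
  zero_mem' := by
    refine ⟨0, ?_, ?_⟩
    · filter_upwards [Lp.coeFn_zero (EuclideanSpace ℂ (Fin d)) 2
        (volume.restrict (Ω : Set (EuclideanSpace ℝ (Fin d))))] with x hx
      rw [gradC_zero]; exact hx
    · filter_upwards [Lp.coeFn_zero ℂ 2 (volume.restrict (Ω : Set (EuclideanSpace ℝ (Fin d))))]
        with x hx
      exact hx.trans (mul_zero _).symm
  add_mem' := by
    rintro p p' ⟨η, h1, h2⟩ ⟨ζ, h3, h4⟩
    refine ⟨η + ζ, ?_, ?_⟩
    · filter_upwards [Lp.coeFn_add p.fst p'.fst, h1, h3] with x hx e1 e3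
      rw [WithLp.add_fst, hx, Pi.add_apply, e1, e3, gradC_add]
    · filter_upwards [Lp.coeFn_add p.snd p'.snd, h2, h4] with x hx e1 e3
      rw [WithLp.add_snd, hx, Pi.add_apply, e1, e3]
      exact (mul_add _ _ _).symm
  smul_mem' := by
    rintro c p ⟨η, h1, h2⟩
    refine ⟨c • η, ?_, ?_⟩
    · filter_upwards [Lp.coeFn_smul c p.fst, h1] with x hx e1
      rw [WithLp.smul_fst, hx, Pi.smul_apply, e1, gradC_smul]
    · filter_upwards [Lp.coeFn_smul c p.snd, h2] with x hx e1
      rw [WithLp.smul_snd, hx, Pi.smul_apply, e1]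
      exact mul_left_comm _ _ _

/-- The space `𝓦(Ω)`: the completion of `C₀^∞(Ω)` with respect to the inner product
`⟨∇ ·, ∇ ·⟩ + ⟨q^{1/2} ·, q^{1/2} ·⟩`, realized as the closure of the image of `C₀^∞(Ω)` under the
isometric embedding `η ↦ (∇η, q^{1/2} η)` into the Hilbert space `L²(Ω; ℂᵈ) ⊕ L²(Ω)`. -/
abbrev energySpace {d : ℕ} (Ω : Opens (EuclideanSpace ℝ (Fin d)))
    (q : EuclideanSpace ℝ (Fin d) → ℝ) : Submodule ℂ (WithLp 2 (L2vec Ω × L2 Ω)) :=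
  (testEnergy Ω q).topologicalClosure

/-- The Hilbert space `𝓗 = 𝓦(Ω) ⊕ L²(Ω)`. -/
abbrev phaseSpace {d : ℕ} (Ω : Opens (EuclideanSpace ℝ (Fin d)))
    (q : EuclideanSpace ℝ (Fin d) → ℝ) : Type :=
  WithLp 2 (energySpace Ω q × L2 Ω)

/-- The graph of the embedding of the form domain `W₀^{1,2}(Ω) ∩ Dom(q^{1/2})` into `𝓦(Ω)`:
`φ ∈ W₀^{1,2}(Ω)` with `q^{1/2} φ ∈ L²(Ω)` is identified with the element `(∇φ, q^{1/2} φ)`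
of `𝓦(Ω)`. (For `0 ≤ q ∈ L¹_loc(Ω)` every `φ` in the form domain occurs here, because `C₀^∞(Ω)` is
dense in the form domain with respect to the form norm.) -/
def energyEmbedding {d : ℕ} (Ω : Opens (EuclideanSpace ℝ (Fin d)))
    (q : EuclideanSpace ℝ (Fin d) → ℝ) : Submodule ℂ (L2 Ω × energySpace Ω q) where
  carrier := {p | (p.1, (p.2 : WithLp 2 (L2vec Ω × L2 Ω)).fst) ∈ sobolevZero Ω ∧
    (p.2 : WithLp 2 (L2vec Ω × L2 Ω)).snd
      =ᵐ[volume.restrict (Ω : Set (EuclideanSpace ℝ (Fin d)))]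
      fun x => ((√(q x) : ℝ) : ℂ) * p.1 x}
  zero_mem' := by
    refine ⟨zero_mem _, ?_⟩
    filter_upwards [Lp.coeFn_zero ℂ 2 (volume.restrict (Ω : Set (EuclideanSpace ℝ (Fin d))))]
      with x hx
    change (0 : L2 Ω) x = _ * (0 : L2 Ω) x
    rw [hx]; simp
  add_mem' := by
    rintro ⟨φ, u⟩ ⟨ψ, v⟩ ⟨h1, h2⟩ ⟨h3, h4⟩
    refine ⟨add_mem h1 h3, ?_⟩
    filter_upwards [Lp.coeFn_add φ ψ, Lp.coeFn_add (u : WithLp 2 (L2vec Ω × L2 Ω)).snd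
      (v : WithLp 2 (L2vec Ω × L2 Ω)).snd, h2, h4] with x e1 e2 e3 e4
    refine e2.trans ?_
    change _ = _ * (φ + ψ : L2 Ω) x
    rw [e1, Pi.add_apply, Pi.add_apply, mul_add]
    exact congrArg₂ (· + ·) e3 e4
  smul_mem' := by
    rintro c ⟨φ, u⟩ ⟨h1, h2⟩
    refine ⟨Submodule.smul_mem _ c h1, ?_⟩
    filter_upwards [Lp.coeFn_smul c φ, Lp.coeFn_smul c (u : WithLp 2 (L2vec Ω × L2 Ω)).snd, h2]
      with x e1 e2 e3
    refine e2.trans ?_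
    change _ = _ * (c • φ : L2 Ω) x
    rw [e1, Pi.smul_apply, Pi.smul_apply, smul_eq_mul, smul_eq_mul, mul_left_comm]
    exact congrArg (c * ·) e3

/-- The subspace `Dom(-Δ + q) ∩ Dom(a)` of `L²(Ω)`. -/
def commonDom {d : ℕ} (Ω : Opens (EuclideanSpace ℝ (Fin d)))
    (a q : EuclideanSpace ℝ (Fin d) → ℝ) : Submodule ℂ (L2 Ω) :=
  (schrodinger Ω q).domain ⊓ (mulOp Ω a).domain

/-- The operator `-Δ + q` on `Dom(-Δ + q) ∩ Dom(a)`. -/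
def schrodingerC {d : ℕ} (Ω : Opens (EuclideanSpace ℝ (Fin d)))
    (a q : EuclideanSpace ℝ (Fin d) → ℝ) : commonDom Ω a q →ₗ[ℂ] L2 Ω :=
  (schrodinger Ω q).toFun.comp (Submodule.inclusion inf_le_left)

/-- The operator of multiplication by `a` on `Dom(-Δ + q) ∩ Dom(a)`. -/
def dampingC {d : ℕ} (Ω : Opens (EuclideanSpace ℝ (Fin d)))
    (a q : EuclideanSpace ℝ (Fin d) → ℝ) : commonDom Ω a q →ₗ[ℂ] L2 Ω :=
  (mulOp Ω a).toFun.comp (Submodule.inclusion inf_le_right)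

/-- The graph of `G₀ (φ₁, φ₂) = (φ₂, -(-Δ + q) φ₁ - 2 a φ₂)` in `𝓗`, where `φ₁` and `φ₂` run through
`Dom(-Δ + q) ∩ Dom(a)`; as first components of elements of `𝓗` they are viewed in `𝓦(Ω)`. -/
def generatorGraph {d : ℕ} (Ω : Opens (EuclideanSpace ℝ (Fin d)))
    (a q : EuclideanSpace ℝ (Fin d) → ℝ) : Submodule ℂ (phaseSpace Ω q × phaseSpace Ω q) where
  carrier := {p | ∃ φ₁ φ₂ : commonDom Ω a q,
    ((φ₁ : L2 Ω), p.1.fst) ∈ energyEmbedding Ω q ∧ p.1.snd = φ₂ ∧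
    ((φ₂ : L2 Ω), p.2.fst) ∈ energyEmbedding Ω q ∧
    p.2.snd = -(schrodingerC Ω a q φ₁) - (2 : ℂ) • dampingC Ω a q φ₂}
  zero_mem' := ⟨0, 0, zero_mem _, rfl, zero_mem _, by
    rw [map_zero, map_zero, neg_zero, smul_zero, sub_zero]; rfl⟩
  add_mem' := by
    rintro p p' ⟨φ₁, φ₂, h1, h2, h3, h4⟩ ⟨ψ₁, ψ₂, k1, k2, k3, k4⟩
    refine ⟨φ₁ + ψ₁, φ₂ + ψ₂, add_mem h1 k1, ?_, add_mem h3 k3, ?_⟩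
    · rw [Prod.fst_add, WithLp.add_snd, h2, k2]; rfl
    · rw [Prod.snd_add, WithLp.add_snd, h4, k4, map_add, map_add, smul_add]; abel
  smul_mem' := by
    rintro c p ⟨φ₁, φ₂, h1, h2, h3, h4⟩
    refine ⟨c • φ₁, c • φ₂, Submodule.smul_mem _ c h1, ?_, Submodule.smul_mem _ c h3, ?_⟩
    · rw [Prod.smul_fst, WithLp.smul_snd, h2]; rfl
    · rw [Prod.smul_snd, WithLp.smul_snd, h4, map_smul, map_smul, smul_sub, smul_neg,
        smul_comm c (2 : ℂ)]

theorem energyEmbedding_fst_eq_zero {d : ℕ} [NeZero d] {Ω : Opens (EuclideanSpace ℝ (Fin d))}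
    {q : EuclideanSpace ℝ (Fin d) → ℝ} {φ : L2 Ω} (h : (φ, 0) ∈ energyEmbedding Ω q) : φ = 0 :=
  sobolevZero_fst_eq_zero h.1

theorem energyEmbedding_snd_eq_zero {d : ℕ} {Ω : Opens (EuclideanSpace ℝ (Fin d))}
    {q : EuclideanSpace ℝ (Fin d) → ℝ} {w : energySpace Ω q} (h : (0, w) ∈ energyEmbedding Ω q) :
    w = 0 := by
  have h1 : (w : WithLp 2 (L2vec Ω × L2 Ω)).fst = 0 := sobolevZero_snd_eq_zero h.1
  have h2 : (w : WithLp 2 (L2vec Ω × L2 Ω)).snd = 0 := by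
    refine Lp.ext ?_
    have := h.2
    filter_upwards [this, Lp.coeFn_zero ℂ 2
      (volume.restrict (Ω : Set (EuclideanSpace ℝ (Fin d))))] with x e1 e2
    rw [e1, e2]; simp
  refine Subtype.ext ((WithLp.ofLp_injective 2) (Prod.ext h1 h2))

theorem generatorGraph_single {d : ℕ} [NeZero d] {Ω : Opens (EuclideanSpace ℝ (Fin d))}
    {a q : EuclideanSpace ℝ (Fin d) → ℝ} (p : phaseSpace Ω q × phaseSpace Ω q)
    (hp : p ∈ generatorGraph Ω a q) (h0 : p.1 = 0) : p.2 = 0 := by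
  obtain ⟨φ₁, φ₂, h1, h2, h3, h4⟩ := hp
  rw [h0] at h1 h2
  have z1 : φ₁ = 0 := Subtype.ext (energyEmbedding_fst_eq_zero h1)
  have z2 : φ₂ = 0 := Subtype.ext h2.symm
  subst z1 z2
  have z3 : p.2.fst = 0 := energyEmbedding_snd_eq_zero h3
  have z4 : p.2.snd = 0 := by
    rw [h4, map_zero, map_zero, neg_zero, smul_zero, sub_zero]
  exact (WithLp.ofLp_injective 2) (Prod.ext z3 z4)

/-- The operator `G₀` in `𝓗` with domain `(Dom(-Δ + q) ∩ Dom(a))²`. -/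
def generatorZero {d : ℕ} (Ω : Opens (EuclideanSpace ℝ (Fin d)))
    (a q : EuclideanSpace ℝ (Fin d) → ℝ) : phaseSpace Ω q →ₗ.[ℂ] phaseSpace Ω q :=
  (generatorGraph Ω a q).toLinearPMap

theorem generatorZero_graph {d : ℕ} [NeZero d] (Ω : Opens (EuclideanSpace ℝ (Fin d)))
    (a q : EuclideanSpace ℝ (Fin d) → ℝ) : (generatorZero Ω a q).graph = generatorGraph Ω a q :=
  Submodule.toLinearPMap_graph_eq _ generatorGraph_single

/-- The operator `G`, the closure of `G₀`. -/
def generator {d : ℕ} (Ω : Opens (EuclideanSpace ℝ (Fin d)))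
    (a q : EuclideanSpace ℝ (Fin d) → ℝ) : phaseSpace Ω q →ₗ.[ℂ] phaseSpace Ω q :=
  (generatorZero Ω a q).closure

/-- The essential spectrum `σ_{e2}(A)`, defined through Weyl singular sequences. -/
def essSpectrum2 {H : Type*} [NormedAddCommGroup H] [InnerProductSpace ℂ H] (A : H →ₗ.[ℂ] H) :
    Set ℂ :=
  {l | ∃ ψ : ℕ → A.domain, (∀ n, ‖(ψ n : H)‖ = 1) ∧
    (∀ v : H, Tendsto (fun n => inner ℂ v (ψ n : H)) atTop (𝓝 0)) ∧
    Tendsto (fun n => A (ψ n) - l • (ψ n : H)) atTop (𝓝 0)}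

/-! ### The assumptions on the coefficients and the tubular neighbourhood -/

/-- `f ∈ L^p_loc(Ω)`. -/
def LocLp {d : ℕ} (Ω : Opens (EuclideanSpace ℝ (Fin d))) (p : ℝ≥0∞)
    (f : EuclideanSpace ℝ (Fin d) → ℝ) : Prop :=
  ∀ K : Set (EuclideanSpace ℝ (Fin d)), K ⊆ Ω → IsCompact K → MemLp f p (volume.restrict K)

/-- `f ∈ L^∞_loc(closure Ω)`: `f` is measurable on `Ω` and essentially bounded on every bounded
part of `Ω`. -/
def LocBdd {d : ℕ} (Ω : Opens (EuclideanSpace ℝ (Fin d))) {F : Type*} [NormedAddCommGroup F]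
    (f : EuclideanSpace ℝ (Fin d) → F) : Prop :=
  ∀ R : ℝ, MemLp f ∞ (volume.restrict ((Ω : Set (EuclideanSpace ℝ (Fin d))) ∩ Metric.ball 0 R))

/-- `f ∈ W^{1,∞}_loc(closure Ω)` with weak gradient `g`. -/
def LocW1Inf {d : ℕ} (Ω : Opens (EuclideanSpace ℝ (Fin d)))
    (f : EuclideanSpace ℝ (Fin d) → ℝ)
    (g : EuclideanSpace ℝ (Fin d) → EuclideanSpace ℝ (Fin d)) : Prop :=
  LocBdd Ω f ∧ LocBdd Ω g ∧ ∀ (η : 𝓓(Ω, ℝ)) (i : Fin d),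
    ∫ x in (Ω : Set (EuclideanSpace ℝ (Fin d))), f x * pderiv i (⇑η) x =
      -∫ x in (Ω : Set (EuclideanSpace ℝ (Fin d))), g x i * η x

/-- The regularity assumptions on the damping `a` and the potential `q`. -/
structure Regular {d : ℕ} (Ω : Opens (EuclideanSpace ℝ (Fin d)))
    (a q : EuclideanSpace ℝ (Fin d) → ℝ) : Prop where
  a_loc : LocLp Ω 2 a
  q_loc : LocLp Ω 1 q
  a_nonneg : ∀ᵐ x ∂volume.restrict (Ω : Set (EuclideanSpace ℝ (Fin d))), 0 ≤ a x
  q_nonneg : ∀ᵐ x ∂volume.restrict (Ω : Set (EuclideanSpace ℝ (Fin d))), 0 ≤ q x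
  /-- the decomposition `a = ar + as` into a regular part `ar` (with gradient `gr`) and a singular
  part `as` -/
  decomposition : ∃ (ar as : EuclideanSpace ℝ (Fin d) → ℝ)
    (gr : EuclideanSpace ℝ (Fin d) → EuclideanSpace ℝ (Fin d)),
    (∀ᵐ x ∂volume.restrict (Ω : Set (EuclideanSpace ℝ (Fin d))), a x = ar x + as x) ∧
    (∀ᵐ x ∂volume.restrict (Ω : Set (EuclideanSpace ℝ (Fin d))), 0 ≤ ar x) ∧
    LocW1Inf Ω ar gr ∧ LocLp Ω 2 as ∧
    (∀ ε > 0, ∃ M > 0, ∀ᵐ x ∂volume.restrict (Ω : Set (EuclideanSpace ℝ (Fin d))),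
      ‖gr x‖ ≤ ε * ar x ^ (3 / 2 : ℝ) + M * (√(q x) + 1)) ∧
    (∀ ε > 0, ∃ M > 0, ∀ (ψ : L2 Ω) (h₁ : ψ ∈ (mulOp Ω ar).domain)
      (h₂ : ψ ∈ (schrodinger Ω q).domain), ∃ h₃ : ψ ∈ (mulOp Ω as).domain,
      ‖mulOp Ω as ⟨ψ, h₃⟩‖ ≤
        ε * (‖schrodinger Ω q ⟨ψ, h₂⟩‖ + ‖mulOp Ω ar ⟨ψ, h₁⟩‖) + M * ‖ψ‖)

/-- The tubular neighbourhood `U_ω = {(x₁, x') : x₁ > 0, |x'| < 1 / ω(x₁)}` of the ray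
`{(x₁, 0) : x₁ > 0}` in `ℝᵈ`. -/
def tube {d : ℕ} [NeZero d] (ω : ℝ → ℝ) : Set (EuclideanSpace ℝ (Fin d)) :=
  {x | 0 < x 0 ∧ √(∑ i ∈ Finset.univ.erase (0 : Fin d), x i ^ 2) < (ω (x 0))⁻¹}

end

end DampedWave

namespace DampedWave

noncomputable section

/-! For a test function φ one has `G (φ, λφ) = λ (φ, λφ) + (0, Δφ - (q + 2λa + λ²)φ)`, and in the
tube the last entry is `Δφ + Aφ - Bφ`. So a singular sequence for `G` at λ comes from approximate
zero-energy solutions of `-Δ - A + B`, a Schrödinger operator whose potential falls to `-∞` along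
the ray. What makes this possible under weak assumptions is the energy norm: it dominates `‖∇φ‖`,
which for an oscillating solution is of order `√A ‖φ‖`. Hence the residual need not be small, only
`o(√A)` relative to φ.

The quasimode is a WKB packet `χ(x₁) exp(iS(x₁))` with `S' ≈ √A`, times cutoffs in the transverse
variables. Every error is then a small multiple of `√A`: the terms `S'χ'` and `χ''` because the
window length `L` is a large constant; `S'' ≈ A'/(2√A)` because `A'/A → 0`; the transverse second
derivatives, of order `ω²`, because `ω⁴/A → 0`; and `Bφ` because `B²/A → 0`. Since `A'/A` and `ω'/ω`
tend to zero, `A` and `ω` change at most by a factor 2 over a window, so one value of each controls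
all of it and a box of fixed proportions fits in the tube. As `A` is only `C¹`, the exact WKB phase
need not be smooth, and it is replaced by a polynomial approximation.

Moving the boxes to infinity makes the normalized sequence converge weakly to zero. The work is
carried by `phaseOfTest_mem_generator` (the identity for `G`), `mem_essSpectrum2_of_testFunctions`
(reduction to an estimate of the residual against the gradient), `exists_approximate_mode` (the
packet on the line), `eventually_exists_width` (room in the tube) and `exists_testFunction`
(assembly). -/

/-! ### Test functions in the domains of `-Δ + q`, `a` and `G` -/

theorem memLp_mul_testFunction {d : ℕ} {Ω : Opens (EuclideanSpace ℝ (Fin d))}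
    {m : EuclideanSpace ℝ (Fin d) → ℝ} (hm : LocLp Ω 2 m) (φ : 𝓓(Ω, ℂ)) :
    MemLp (fun x => (m x : ℂ) * φ x) 2
      (volume.restrict (Ω : Set (EuclideanSpace ℝ (Fin d)))) := by
  have hK : IsCompact (tsupport (⇑φ)) := φ.hasCompactSupport
  obtain ⟨C, hC⟩ := φ.continuous.bounded_above_of_compact_support φ.hasCompactSupport
  have h1 : MemLp (fun x => (m x : ℂ) * φ x) 2 (volume.restrict (tsupport (⇑φ))) := by
    have hm1 := hm _ φ.tsupport_subset hK
    refine hm1.of_le_mul (c := C) ?_ (ae_of_all _ fun x => ?_)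
    · exact (Complex.continuous_ofReal.comp_aestronglyMeasurable hm1.1).mul
        φ.continuous.aestronglyMeasurable
    · rw [norm_mul, Complex.norm_real, mul_comm]
      exact mul_le_mul_of_nonneg_right (hC x) (norm_nonneg _)
  -- Integrability of `m` is only known on compact sets; since the product vanishes off the support
  -- of φ, the bound there passes to all of Ω.
  rw [← memLp_indicator_iff_restrict hK.measurableSet] at h1
  have e : (tsupport (⇑φ)).indicator (fun x => (m x : ℂ) * φ x) = fun x => (m x : ℂ) * φ x := by
    refine Set.indicator_eq_self.2 fun x hx => ?_
    by_contra h
    exact hx (by simp [image_eq_zero_of_notMem_tsupport h])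
  rw [e] at h1
  exact h1.restrict _

/-- Follows from `√m ≤ 1 + |m|` and the finiteness of the measure of compact sets. It puts
`q^{1/2}φ` in `L²` for test functions, as the energy space requires. -/
theorem LocLp.sqrt {d : ℕ} {Ω : Opens (EuclideanSpace ℝ (Fin d))}
    {m : EuclideanSpace ℝ (Fin d) → ℝ} (hm : LocLp Ω 2 m) : LocLp Ω 2 fun x => √(m x) := by
  intro K hK hKc
  have hm1 := hm K hK hKc
  have : IsFiniteMeasure (volume.restrict K) := ⟨by
    rw [Measure.restrict_apply_univ]; exact hKc.measure_lt_top⟩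
  have h2 : MemLp (fun x => 1 + ‖m x‖) 2 (volume.restrict K) :=
    (memLp_const (1 : ℝ)).add hm1.norm
  refine h2.of_le (Real.continuous_sqrt.comp_aestronglyMeasurable hm1.1) (ae_of_all _ fun x => ?_)
  rw [Real.norm_of_nonneg (Real.sqrt_nonneg _), Real.norm_of_nonneg (by positivity)]
  refine Real.sqrt_le_iff.2 ⟨by positivity, ?_⟩
  have := le_abs_self (m x)
  rw [Real.norm_eq_abs]
  nlinarith [abs_nonneg (m x)]

/-- The partial derivative of a test function, as a test function. -/
def pderivTest {d : ℕ} {Ω : Opens (EuclideanSpace ℝ (Fin d))} (i : Fin d) (φ : 𝓓(Ω, ℂ)) :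
    𝓓(Ω, ℂ) :=
  ⟨pderiv i (⇑φ), (φ.contDiff.fderiv_right (m := (⊤ : ℕ∞)) (by simp)).clm_apply contDiff_const,
    hasCompactSupport_pderiv i φ, (tsupport_fderiv_apply_subset ℝ _).trans φ.tsupport_subset⟩

/-- The Laplacian of a function on `ℝᵈ`. -/
def lap {d : ℕ} (η : EuclideanSpace ℝ (Fin d) → ℂ) (x : EuclideanSpace ℝ (Fin d)) : ℂ :=
  ∑ i, pderiv i (pderiv i η) x

section

variable {d : ℕ} {Ω : Opens (EuclideanSpace ℝ (Fin d))}

theorem memLp_testFunction (φ : 𝓓(Ω, ℂ)) :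
    MemLp (⇑φ) 2 (volume.restrict (Ω : Set (EuclideanSpace ℝ (Fin d)))) :=
  (φ.continuous.memLp_of_hasCompactSupport φ.hasCompactSupport).restrict _

theorem memLp_lap (φ : 𝓓(Ω, ℂ)) :
    MemLp (lap (⇑φ)) 2 (volume.restrict (Ω : Set (EuclideanSpace ℝ (Fin d)))) :=
  memLp_finsetSum _ fun i _ => memLp_testFunction (pderivTest i (pderivTest i φ))

theorem memLp_gradC (φ : 𝓓(Ω, ℂ)) :
    MemLp (gradC (⇑φ)) 2 (volume.restrict (Ω : Set (EuclideanSpace ℝ (Fin d)))) := by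
  have hc : Continuous (gradC (⇑φ)) :=
    (PiLp.continuous_toLp 2 _).comp (continuous_pi fun i => continuous_pderiv i φ)
  refine (hc.memLp_of_hasCompactSupport ?_).restrict _
  refine φ.hasCompactSupport.mono' (Function.support_subset_iff'.2 fun x hx => ?_)
  ext i
  have := (tsupport_fderiv_apply_subset (f := ⇑φ) ℝ (EuclideanSpace.single i 1)).trans subset_rfl
  exact image_eq_zero_of_notMem_tsupport (f := pderiv i (⇑φ)) fun h => hx (this h)

/-- Both integrands vanish off Ω, so the integration by parts takes place on all of `ℝᵈ` and no
regularity of the boundary enters. -/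
theorem integral_pderiv_mul_pderiv (i : Fin d) (φ η : 𝓓(Ω, ℂ)) :
    ∫ x in (Ω : Set (EuclideanSpace ℝ (Fin d))), pderiv i (⇑φ) x * pderiv i (⇑η) x =
      -∫ x in (Ω : Set (EuclideanSpace ℝ (Fin d))), pderiv i (pderiv i (⇑φ)) x * η x := by
  have hz : ∀ (ζ : 𝓓(Ω, ℂ)), ∀ x ∉ (Ω : Set (EuclideanSpace ℝ (Fin d))), ζ x = 0 := fun ζ x hx =>
    image_eq_zero_of_notMem_tsupport fun h => hx (ζ.tsupport_subset h)
  set ζ := pderivTest i φ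
  rw [setIntegral_eq_integral_of_forall_compl_eq_zero fun x hx => by
      simp [show pderiv i (⇑φ) x = 0 from hz ζ x hx],
    setIntegral_eq_integral_of_forall_compl_eq_zero fun x hx => by simp [hz η x hx]]
  refine integral_mul_fderiv_eq_neg_fderiv_mul_of_integrable (f := ⇑ζ) (g := ⇑η) ?_ ?_ ?_ ?_ ?_
  · exact ((continuous_pderiv i ζ).mul η.continuous).integrable_of_hasCompactSupport
      (η.hasCompactSupport.mul_left)
  · exact (ζ.continuous.mul (continuous_pderiv i η)).integrable_of_hasCompactSupport
      (ζ.hasCompactSupport.mul_right)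
  · exact (ζ.continuous.mul η.continuous).integrable_of_hasCompactSupport
      (ζ.hasCompactSupport.mul_right)
  · exact fun x _ => (ζ.contDiff.differentiable (by simp)) x
  · exact fun x _ => (η.contDiff.differentiable (by simp)) x

/-- On test functions, the Dirichlet realization of `-Δ + q` acts as expected. -/
theorem testFunction_mem_schrodingerGraph {q : EuclideanSpace ℝ (Fin d) → ℝ}
    (hq : LocLp Ω 2 q) (φ : 𝓓(Ω, ℂ)) :
    ((memLp_testFunction φ).toLp _,
      (memLp_mul_testFunction hq φ).toLp _ - (memLp_lap φ).toLp _) ∈ schrodingerGraph Ω q := by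
  have e0 := (memLp_testFunction φ).coeFn_toLp
  have eg := (memLp_gradC φ).coeFn_toLp
  have hd : ∀ η : 𝓓(Ω, ℂ), Integrable (fun x => (q x : ℂ) * φ x * η x)
      (volume.restrict (Ω : Set (EuclideanSpace ℝ (Fin d)))) := fun η =>
    (memLp_mul_testFunction hq φ).integrable_mul (q := 2) (memLp_testFunction η)
  refine ⟨(memLp_gradC φ).toLp _, subset_closure ⟨φ, e0, eg⟩, ?_, fun η => ?_, fun η => ?_⟩
  · refine (memLp_mul_testFunction hq.sqrt φ).ae_eq ?_
    filter_upwards [e0] with x hx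
    rw [hx]
  · refine (hd η).congr ?_
    filter_upwards [e0] with x hx
    rw [hx]
  · have ip : ∀ i, Integrable (fun x => pderiv i (⇑φ) x * pderiv i (⇑η) x)
        (volume.restrict (Ω : Set (EuclideanSpace ℝ (Fin d)))) := fun i =>
      (memLp_testFunction (pderivTest i φ)).integrable_mul (q := 2)
        (memLp_testFunction (pderivTest i η))
    have ip2 : ∀ i, Integrable (fun x => pderiv i (pderiv i (⇑φ)) x * η x)
        (volume.restrict (Ω : Set (EuclideanSpace ℝ (Fin d)))) := fun i =>
      (memLp_testFunction (pderivTest i (pderivTest i φ))).integrable_mul (q := 2)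
        (memLp_testFunction η)
    have il : Integrable (fun x => lap (⇑φ) x * η x)
        (volume.restrict (Ω : Set (EuclideanSpace ℝ (Fin d)))) :=
      (memLp_lap φ).integrable_mul (q := 2) (memLp_testFunction η)
    have e1 : ∫ x in (Ω : Set (EuclideanSpace ℝ (Fin d))),
        ((∑ i, pderiv i (⇑φ) x * pderiv i (⇑η) x) + (q x : ℂ) * φ x * η x) =
        ∫ x in (Ω : Set (EuclideanSpace ℝ (Fin d))),
          ((q x : ℂ) * φ x * η x - lap (⇑φ) x * η x) := by
      rw [integral_add (integrable_finsetSum _ fun i _ => ip i) (hd η), integral_sub (hd η) il,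
        integral_finsetSum _ fun i _ => ip i]
      simp only [integral_pderiv_mul_pderiv, lap, Finset.sum_mul]
      rw [integral_finsetSum _ fun i _ => ip2 i, Finset.sum_neg_distrib]
      ring
    refine Eq.trans (integral_congr_ae ?_) (e1.trans (integral_congr_ae ?_))
    · filter_upwards [e0, eg] with x hx hx2
      rw [hx, hx2]; rfl
    · filter_upwards [Lp.coeFn_sub ((memLp_mul_testFunction hq φ).toLp _)
        ((memLp_lap φ).toLp _), (memLp_mul_testFunction hq φ).coeFn_toLp,
        (memLp_lap φ).coeFn_toLp] with x h1 h2 h3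
      rw [h1, Pi.sub_apply, h2, h3, sub_mul]

theorem testFunction_mem_commonDom {a q : EuclideanSpace ℝ (Fin d) → ℝ}
    (ha : LocLp Ω 2 a) (hq : LocLp Ω 2 q) (φ : 𝓓(Ω, ℂ)) :
    (memLp_testFunction φ).toLp _ ∈ commonDom Ω a q := by
  refine ⟨?_, ?_⟩
  · have h := testFunction_mem_schrodingerGraph hq φ
    rw [← schrodinger_graph] at h
    exact LinearPMap.mem_domain_of_mem_graph h
  · refine (memLp_mul_testFunction ha φ).ae_eq ?_
    filter_upwards [(memLp_testFunction φ).coeFn_toLp] with x hx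
    rw [hx]

/-- The operator is defined through its graph, so its value at φ is read off from the pair found in
`testFunction_mem_schrodingerGraph`. -/
theorem schrodingerC_testFunction {a q : EuclideanSpace ℝ (Fin d) → ℝ}
    (ha : LocLp Ω 2 a) (hq : LocLp Ω 2 q) (φ : 𝓓(Ω, ℂ)) :
    schrodingerC Ω a q ⟨_, testFunction_mem_commonDom ha hq φ⟩ =
      (memLp_mul_testFunction hq φ).toLp _ - (memLp_lap φ).toLp _ := by
  have h := testFunction_mem_schrodingerGraph hq φ
  rw [← schrodinger_graph, LinearPMap.mem_graph_iff] at h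
  obtain ⟨y, h1, h2⟩ := h
  refine Eq.trans ?_ h2
  change schrodinger Ω q _ = _
  congr 1
  exact Subtype.ext h1.symm

theorem dampingC_testFunction {a q : EuclideanSpace ℝ (Fin d) → ℝ}
    (ha : LocLp Ω 2 a) (hq : LocLp Ω 2 q) (φ : 𝓓(Ω, ℂ)) :
    dampingC Ω a q ⟨_, testFunction_mem_commonDom ha hq φ⟩ =
      (memLp_mul_testFunction ha φ).toLp _ := by
  refine MemLp.toLp_congr (testFunction_mem_commonDom ha hq φ).2 _ ?_
  filter_upwards [(memLp_testFunction φ).coeFn_toLp] with x hx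
  rw [hx]

/-- The element of the energy space given by a test function. -/
def energyOfTest {q : EuclideanSpace ℝ (Fin d) → ℝ} (hq : LocLp Ω 2 q) (φ : 𝓓(Ω, ℂ)) :
    energySpace Ω q :=
  ⟨WithLp.toLp 2 ((memLp_gradC φ).toLp _, (memLp_mul_testFunction hq.sqrt φ).toLp _),
    subset_closure ⟨φ, (memLp_gradC φ).coeFn_toLp, (memLp_mul_testFunction hq.sqrt φ).coeFn_toLp⟩⟩

theorem energyOfTest_mem {q : EuclideanSpace ℝ (Fin d) → ℝ} (hq : LocLp Ω 2 q) (φ : 𝓓(Ω, ℂ)) :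
    ((memLp_testFunction φ).toLp _, energyOfTest hq φ) ∈ energyEmbedding Ω q := by
  refine ⟨subset_closure ⟨φ, (memLp_testFunction φ).coeFn_toLp, (memLp_gradC φ).coeFn_toLp⟩, ?_⟩
  refine (memLp_mul_testFunction hq.sqrt φ).coeFn_toLp.trans ?_
  filter_upwards [(memLp_testFunction φ).coeFn_toLp] with x hx
  rw [hx]

/-- The function `Δφ - (q + 2 λ a + λ²) φ`. -/
def residual (a q : EuclideanSpace ℝ (Fin d) → ℝ) (lam : ℝ) (φ : EuclideanSpace ℝ (Fin d) → ℂ)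
    (x : EuclideanSpace ℝ (Fin d)) : ℂ :=
  lap φ x - ((q x + 2 * lam * a x + lam ^ 2 : ℝ) : ℂ) * φ x

theorem memLp_residual {a q : EuclideanSpace ℝ (Fin d) → ℝ} (ha : LocLp Ω 2 a) (hq : LocLp Ω 2 q)
    (lam : ℝ) (φ : 𝓓(Ω, ℂ)) :
    MemLp (residual a q lam (⇑φ)) 2 (volume.restrict (Ω : Set (EuclideanSpace ℝ (Fin d)))) := by
  have h := (memLp_lap φ).sub (((memLp_mul_testFunction hq φ).add
    ((memLp_mul_testFunction ha φ).const_mul (2 * lam : ℂ))).add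
    ((memLp_testFunction φ).const_mul (lam ^ 2 : ℂ)))
  refine h.ae_eq (ae_of_all _ fun x => ?_)
  simp only [Pi.sub_apply, Pi.add_apply, residual]
  push_cast
  ring

/-- The phase space vector `(φ, λ φ)`. -/
def phaseOfTest {q : EuclideanSpace ℝ (Fin d) → ℝ} (hq : LocLp Ω 2 q) (lam : ℝ) (φ : 𝓓(Ω, ℂ)) :
    phaseSpace Ω q :=
  WithLp.toLp 2 (energyOfTest hq φ, (lam : ℂ) • (memLp_testFunction φ).toLp _)

/-- `G` maps `(φ, λ φ)` to `λ (φ, λ φ) + (0, Δφ - (q + 2 λ a + λ²) φ)`. -/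
theorem phaseOfTest_mem_generator [NeZero d] {a q : EuclideanSpace ℝ (Fin d) → ℝ}
    (ha : LocLp Ω 2 a) (hq : LocLp Ω 2 q) (lam : ℝ) (φ : 𝓓(Ω, ℂ)) :
    (phaseOfTest hq lam φ, (lam : ℂ) • phaseOfTest hq lam φ +
      WithLp.toLp 2 (0, (memLp_residual ha hq lam φ).toLp _)) ∈ (generator Ω a q).graph := by
  -- The pair already lies in the graph of `G₀`; of the closure only the inclusion `G₀ ≤ G` is used.
  refine LinearPMap.le_graph_of_le (LinearPMap.le_closure _) ?_
  rw [generatorZero_graph]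
  set v : commonDom Ω a q := ⟨_, testFunction_mem_commonDom ha hq φ⟩
  refine ⟨v, (lam : ℂ) • v, energyOfTest_mem hq φ, rfl, ?_, ?_⟩
  · have := Submodule.smul_mem _ (lam : ℂ) (energyOfTest_mem hq φ)
    change (_, (lam : ℂ) • energyOfTest hq φ + 0) ∈ energyEmbedding Ω q
    rw [add_zero]
    exact this
  · rw [map_smul, schrodingerC_testFunction ha hq, dampingC_testFunction ha hq]
    -- In the second component the `-λ²φ` of the residual cancels `λ · λφ`, leaving `Δφ - qφ -
    -- 2λaφ`.
    change (lam : ℂ) • ((lam : ℂ) • (memLp_testFunction φ).toLp _) +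
      (memLp_residual ha hq lam φ).toLp _ = _
    rw [← MemLp.toLp_const_smul, ← MemLp.toLp_const_smul, ← MemLp.toLp_const_smul,
      ← MemLp.toLp_const_smul, ← MemLp.toLp_sub, ← MemLp.toLp_neg, ← MemLp.toLp_sub,
      ← MemLp.toLp_add]
    refine MemLp.toLp_congr _ _ (ae_of_all _ fun x => ?_)
    simp only [Pi.sub_apply, Pi.add_apply, Pi.neg_apply, Pi.smul_apply, residual, smul_eq_mul]
    push_cast
    ring

end

end

/-! ### Weyl sequences from test functions escaping to infinity -/

/-- A bounded sequence in `L²` whose supports escape to infinity converges weakly to zero. -/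
theorem tendsto_inner_of_escaping_support {X F : Type*} [MeasurableSpace X] {μ : Measure X}
    [NormedAddCommGroup F] [InnerProductSpace ℂ F] {E : ℕ → Set X}
    (hE : ∀ n, MeasurableSet (E n)) (hanti : Antitone E) (hempty : ⋂ n, E n = ∅)
    (f : Lp F 2 μ) (g : ℕ → Lp F 2 μ) (hg : ∀ n, ‖g n‖ ≤ 1)
    (hs : ∀ n, ∀ᵐ x ∂μ, x ∉ E n → g n x = 0) :
    Tendsto (fun n => inner ℂ f (g n)) atTop (𝓝 0) := by
  have hm : ∀ n, MemLp ((E n).indicator f) 2 μ := fun n => (Lp.memLp f).indicator (hE n)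
  -- The pairing sees only the part of `f` on `E n`, so by Cauchy–Schwarz it is bounded by the `L²`
  -- norm of that tail, whose square is the integral of `|f|²` over sets decreasing to the empty
  -- set.
  have h1 : ∀ n, inner ℂ f (g n) = inner ℂ ((hm n).toLp _) (g n) := fun n => by
    rw [L2.inner_def, L2.inner_def]
    refine integral_congr_ae ?_
    filter_upwards [hs n, (hm n).coeFn_toLp] with x hx e
    rw [e]
    by_cases h : x ∈ E n
    · rw [Set.indicator_of_mem h]
    · rw [hx h, inner_zero_right, inner_zero_right]
  have h2 : ∀ n, ((‖(hm n).toLp _‖ : ℂ)) ^ 2 = ∫ x in E n, inner ℂ (f x) (f x) ∂μ := fun n => by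
    have := inner_self_eq_norm_sq_to_K (𝕜 := ℂ) ((hm n).toLp _)
    rw [L2.inner_def] at this
    refine this.symm.trans ?_
    rw [← integral_indicator (hE n)]
    refine integral_congr_ae ?_
    filter_upwards [(hm n).coeFn_toLp] with x e
    rw [e]
    by_cases h : x ∈ E n
    · rw [Set.indicator_of_mem h, Set.indicator_of_mem h]
    · rw [Set.indicator_of_notMem h, Set.indicator_of_notMem h, inner_zero_right]
  have h3 := tendsto_setIntegral_of_antitone hE hanti
    ⟨0, (L2.integrable_inner (𝕜 := ℂ) f f).integrableOn⟩
  rw [hempty, setIntegral_empty] at h3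
  have h4 : Tendsto (fun n => ‖(hm n).toLp _‖ ^ 2) atTop (𝓝 0) := by
    have h5 := h3.norm
    simp only [← h2, norm_zero, norm_pow, Complex.norm_real, norm_norm] at h5
    exact h5
  have h6 : Tendsto (fun n => ‖(hm n).toLp _‖) atTop (𝓝 0) := by
    have := h4.sqrt
    simpa only [Real.sqrt_sq (norm_nonneg _), Real.sqrt_zero] using this
  refine squeeze_zero_norm (fun n => ?_) h6
  rw [h1]
  refine (norm_inner_le_norm _ _).trans ?_
  exact mul_le_of_le_one_right (norm_nonneg _) (hg n)

/-- The strict inequality leaves a whole neighbourhood of `x` on which φ vanishes. It transfers the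
support condition from φ to its gradient. -/
theorem gradC_eq_zero_of_lt {d : ℕ} [NeZero d] {φ : EuclideanSpace ℝ (Fin d) → ℂ} {r : ℝ}
    (h : ∀ x : EuclideanSpace ℝ (Fin d), x 0 ≤ r → φ x = 0) {x : EuclideanSpace ℝ (Fin d)}
    (hx : x 0 < r) : gradC φ x = 0 := by
  have ho : {y : EuclideanSpace ℝ (Fin d) | y 0 < r} ∈ 𝓝 x :=
    (isOpen_lt (by fun_prop) continuous_const).mem_nhds hx
  have he : φ =ᶠ[𝓝 x] fun _ => 0 := by
    filter_upwards [ho] with y hy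
    exact h y (le_of_lt hy)
  ext i
  change fderiv ℝ φ x _ = 0
  rw [he.fderiv_eq]
  simp

/-- Test functions escaping to infinity along the first axis, with small residual relative to their
gradient, give a singular sequence for `G`. -/
theorem mem_essSpectrum2_of_testFunctions {d : ℕ} [NeZero d] {Ω : Opens (EuclideanSpace ℝ (Fin d))}
    {a q : EuclideanSpace ℝ (Fin d) → ℝ} (ha : LocLp Ω 2 a) (hq : LocLp Ω 2 q) (lam : ℝ)
    (h : ∀ n : ℕ, ∃ φ : 𝓓(Ω, ℂ), (∀ x : EuclideanSpace ℝ (Fin d), x 0 ≤ n → φ x = 0) ∧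
      eLpNorm (gradC (⇑φ)) 2 (volume.restrict (Ω : Set (EuclideanSpace ℝ (Fin d)))) ≠ 0 ∧
      eLpNorm (residual a q lam (⇑φ)) 2
          (volume.restrict (Ω : Set (EuclideanSpace ℝ (Fin d)))) ≤
        ENNReal.ofReal (1 / ((n : ℝ) + 1)) * eLpNorm (gradC (⇑φ)) 2
          (volume.restrict (Ω : Set (EuclideanSpace ℝ (Fin d))))) :
    (lam : ℂ) ∈ essSpectrum2 (generator Ω a q) := by
  choose φ hsupp hpos hres using h
  set P : ℕ → phaseSpace Ω q := fun n => phaseOfTest hq lam (φ n) with hP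
  set g : ℕ → L2vec Ω := fun n => (memLp_gradC (φ n)).toLp _ with hg
  set R : ℕ → L2 Ω := fun n => (memLp_residual ha hq lam (φ n)).toLp _ with hR
  -- The gradient is one component of the phase space vector; this is how the energy norm enters,
  -- and why the residual is measured against `∇φ` rather than φ.
  have hgP : ∀ n, ‖g n‖ ≤ ‖P n‖ := fun n =>
    (WithLp.norm_fst_le _ (energyOfTest hq (φ n)).1).trans (WithLp.norm_fst_le _ (P n))
  have hg0 : ∀ n, 0 < ‖g n‖ := fun n => by
    rw [hg]
    simp only
    rw [Lp.norm_toLp]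
    exact ENNReal.toReal_pos (hpos n) (memLp_gradC (φ n)).2.ne
  have hP0 : ∀ n, 0 < ‖P n‖ := fun n => (hg0 n).trans_le (hgP n)
  have hRg : ∀ n : ℕ, ‖R n‖ ≤ 1 / ((n : ℝ) + 1) * ‖g n‖ := fun n => by
    rw [hR, hg]
    simp only
    rw [Lp.norm_toLp, Lp.norm_toLp]
    have := ENNReal.toReal_mono
      (ENNReal.mul_ne_top ENNReal.ofReal_ne_top (memLp_gradC (φ n)).2.ne) (hres n)
    rwa [ENNReal.toReal_mul, ENNReal.toReal_ofReal (by positivity)] at this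
  set c : ℕ → ℂ := fun n => ((‖P n‖⁻¹ : ℝ) : ℂ) with hc
  have hcn : ∀ n, ‖c n‖ = ‖P n‖⁻¹ := fun n => by
    rw [hc]
    simp only [Complex.norm_real]
    exact Real.norm_of_nonneg (inv_nonneg.2 (norm_nonneg _))
  have hgr := fun n => Submodule.smul_mem _ (c n) (phaseOfTest_mem_generator ha hq lam (φ n))
  simp only [LinearPMap.mem_graph_iff] at hgr
  choose ψ hψ1 hψ2 using hgr
  have hψP : ∀ n, (ψ n : phaseSpace Ω q) = c n • P n := hψ1
  have hψ : ∀ n, ‖(ψ n : phaseSpace Ω q)‖ = 1 := fun n => by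
    rw [hψP, norm_smul, hcn, inv_mul_cancel₀ (hP0 n).ne']
  refine ⟨ψ, hψ, fun v => ?_, ?_⟩
  -- The inner product of the phase space is a sum of three `L²` products, with `∇φ`, `q^{1/2}φ` and
  -- `λφ`; each factor is supported in the half space `E n`, so each product tends to zero.
  · set E : ℕ → Set (EuclideanSpace ℝ (Fin d)) := fun n => {x | (n : ℝ) ≤ x 0} with hE
    have hEm : ∀ n, MeasurableSet (E n) := fun n =>
      (isClosed_le continuous_const (by fun_prop)).measurableSet
    have hEa : Antitone E := fun m n hmn x hx =>
      le_trans (Nat.cast_le.2 hmn) (show (n : ℝ) ≤ x 0 from hx)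
    have hEe : ⋂ n, E n = ∅ := by
      refine Set.eq_empty_iff_forall_notMem.2 fun x hx => ?_
      obtain ⟨n, hn⟩ := exists_nat_gt (x 0)
      exact absurd (Set.mem_iInter.1 hx n) (not_le.2 hn)
    have hz : ∀ n x, x ∉ E n → φ n x = 0 := fun n x hx => hsupp n x (not_le.1 hx).le
    have t1 := tendsto_inner_of_escaping_support hEm hEa hEe
      (v.fst : WithLp 2 (L2vec Ω × L2 Ω)).fst
      (fun n => ((ψ n : phaseSpace Ω q).fst : WithLp 2 (L2vec Ω × L2 Ω)).fst)
      (fun n => (WithLp.norm_fst_le _ _).trans ((WithLp.norm_fst_le _ _).trans (hψ n).le)) (fun n => by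
        rw [hψP]
        change ∀ᵐ x ∂_, x ∉ E n → (c n • g n) x = 0
        filter_upwards [Lp.coeFn_smul (c n) (g n), (memLp_gradC (φ n)).coeFn_toLp] with x h1 h2 hx
        rw [h1, Pi.smul_apply, h2, gradC_eq_zero_of_lt (hsupp n) (not_le.1 hx), smul_zero])
    have t2 := tendsto_inner_of_escaping_support hEm hEa hEe
      (v.fst : WithLp 2 (L2vec Ω × L2 Ω)).snd
      (fun n => ((ψ n : phaseSpace Ω q).fst : WithLp 2 (L2vec Ω × L2 Ω)).snd)
      (fun n => (WithLp.norm_snd_le _ _).trans ((WithLp.norm_fst_le _ _).trans (hψ n).le)) (fun n => by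
        rw [hψP]
        change ∀ᵐ x ∂_, x ∉ E n → (c n • (memLp_mul_testFunction hq.sqrt (φ n)).toLp _ : L2 Ω) x = 0
        filter_upwards [Lp.coeFn_smul (c n) ((memLp_mul_testFunction hq.sqrt (φ n)).toLp _),
          (memLp_mul_testFunction hq.sqrt (φ n)).coeFn_toLp] with x h1 h2 hx
        rw [h1, Pi.smul_apply, h2, hz n x hx, mul_zero, smul_zero])
    have t3 := tendsto_inner_of_escaping_support hEm hEa hEe v.snd
      (fun n => (ψ n : phaseSpace Ω q).snd)
      (fun n => (WithLp.norm_snd_le _ _).trans (hψ n).le) (fun n => by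
        rw [hψP]
        change ∀ᵐ x ∂_, x ∉ E n →
          (c n • ((lam : ℂ) • (memLp_testFunction (φ n)).toLp _) : L2 Ω) x = 0
        filter_upwards [Lp.coeFn_smul (c n) ((lam : ℂ) • (memLp_testFunction (φ n)).toLp _),
          Lp.coeFn_smul (lam : ℂ) ((memLp_testFunction (φ n)).toLp _),
          (memLp_testFunction (φ n)).coeFn_toLp] with x h1 h2 h3 hx
        rw [h1, Pi.smul_apply, h2, Pi.smul_apply, h3, hz n x hx, smul_zero, smul_zero])
    have t := (t1.add t2).add t3
    rw [add_zero, add_zero] at t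
    exact t
  -- After normalization the defect is `(0, R n) / ‖P n‖`, and `‖R n‖ ≤ ‖g n‖ / (n + 1) ≤ ‖P n‖ / (n
  -- + 1)`.
  · have e : ∀ n, generator Ω a q (ψ n) - (lam : ℂ) • (ψ n : phaseSpace Ω q) =
        c n • WithLp.toLp 2 (0, R n) := fun n => by
      rw [hψ2, hψP]
      simp only [Prod.smul_snd, smul_add]
      rw [smul_comm (c n) (lam : ℂ)]
      exact add_sub_cancel_left _ _
    simp only [e]
    refine squeeze_zero_norm (fun n => ?_) tendsto_one_div_add_atTop_nhds_zero_nat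
    have hn : ‖(WithLp.toLp 2 (0, R n) : phaseSpace Ω q)‖ = ‖R n‖ := by
      refine (sq_eq_sq₀ (norm_nonneg _) (norm_nonneg _)).1 ?_
      rw [WithLp.prod_norm_sq_eq_of_L2]
      simp
    rw [norm_smul, hn, hcn, inv_mul_le_iff₀ (hP0 n), mul_comm]
    exact (hRg n).trans (mul_le_mul_of_nonneg_left (hgP n) (by positivity))

/-! ### One-dimensional ingredients -/

/-- A positive function with vanishing logarithmic derivative at infinity varies slowly. -/
theorem eventually_slowly_varying {f : ℝ → ℝ} (hd : DifferentiableOn ℝ f (Set.Ioi 0))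
    (hpos : ∀ᶠ u in atTop, 0 < f u) (hf : Tendsto (fun u => deriv f u / f u) atTop (𝓝 0))
    (R : ℝ) (hR : 0 < R) :
    ∀ᶠ c in atTop, ∀ t ∈ Set.Icc (c - R) (c + R), f t ≤ 2 * f c ∧ f c ≤ 2 * f t := by
  -- With `|(log f)'| ≤ log 2 / R`, the mean value inequality over a distance at most `R` changes
  -- `log f` by at most `log 2`, that is, `f` by a factor at most 2.
  have hη : 0 < Real.log 2 / R := div_pos (Real.log_pos one_lt_two) hR
  have h1 : ∀ᶠ u in atTop, 0 < f u ∧ |deriv f u / f u| < Real.log 2 / R ∧ 0 < u := by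
    have := hf.abs
    rw [abs_zero] at this
    filter_upwards [hpos, this.eventually_lt_const hη, eventually_gt_atTop 0] with u a b c
    exact ⟨a, b, c⟩
  have h2 : Tendsto (fun c : ℝ => c - R) atTop atTop := tendsto_atTop_add_const_right _ _ tendsto_id
  filter_upwards [h2.eventually (eventually_forall_ge_atTop.2 h1)] with c hc t ht
  have hlog : ∀ u ∈ Set.Icc (c - R) (c + R),
      HasDerivWithinAt (fun u => Real.log (f u)) (deriv f u / f u) (Set.Icc (c - R) (c + R)) u := by
    intro u hu
    obtain ⟨p1, -, p3⟩ := hc u hu.1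
    exact (((hd.differentiableAt (Ioi_mem_nhds p3)).hasDerivAt).log p1.ne').hasDerivWithinAt
  have hcm : c ∈ Set.Icc (c - R) (c + R) := ⟨by linarith, by linarith⟩
  have key := Convex.norm_image_sub_le_of_norm_hasDerivWithin_le hlog
    (fun u hu => (hc u hu.1).2.1.le) (convex_Icc _ _) hcm ht
  have hb : |Real.log (f t) - Real.log (f c)| ≤ Real.log 2 := by
    refine key.trans ?_
    have : ‖t - c‖ ≤ R := abs_le.2 ⟨by linarith [ht.1], by linarith [ht.2]⟩
    calc _ ≤ Real.log 2 / R * R := mul_le_mul_of_nonneg_left this hη.le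
      _ = Real.log 2 := div_mul_cancel₀ _ hR.ne'
  obtain ⟨b1, b2⟩ := abs_le.1 hb
  have pt := (hc t ht.1).1
  have pc := (hc c hcm.1).1
  constructor
  · rw [← Real.log_le_log_iff pt (by positivity), Real.log_mul two_ne_zero pc.ne']
    linarith
  · rw [← Real.log_le_log_iff pc (by positivity), Real.log_mul two_ne_zero pt.ne']
    linarith

/-- A `C¹` function on a compact interval is approximated in `C¹` by the derivative of a smooth
function. -/
theorem exists_smooth_phase {f f' : ℝ → ℝ} {α β : ℝ} (hαβ : α ≤ β)
    (hf : ∀ t ∈ Set.Icc α β, HasDerivAt f (f' t) t) (hf' : ContinuousOn f' (Set.Icc α β))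
    {ε : ℝ} (hε : 0 < ε) :
    ∃ S : ℝ → ℝ, ContDiff ℝ (⊤ : ℕ∞) S ∧ ∀ t ∈ Set.Icc α β,
      |deriv S t - f t| ≤ ε ∧ |deriv (deriv S) t - f' t| ≤ ε := by
  have hl : 0 < β - α + 1 := by linarith
  -- Weierstrass approximation is applied to `f'`; integrating once from the value `f α` gives `S'`,
  -- integrating again gives `S`. The `+ 1` in the tolerance keeps the divisor positive when `α = β`
  -- and the tolerance itself at most `ε`.
  obtain ⟨p, hp⟩ := exists_polynomial_near_of_continuousOn α β f' hf' (ε / (β - α + 1))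
    (div_pos hε hl)
  set k : ℝ → ℝ := fun t => f α + ∫ s in α..t, p.eval s with hk
  have hkd : ∀ t, HasDerivAt k (p.eval t) t := fun t =>
    (p.continuous.integral_hasStrictDerivAt α t).hasDerivAt.const_add _
  have hkc : Continuous k := continuous_iff_continuousAt.2 fun t => (hkd t).continuousAt
  have hSd : ∀ t, HasDerivAt (fun t => ∫ s in α..t, k s) (k t) t := fun t =>
    (hkc.integral_hasStrictDerivAt α t).hasDerivAt
  have e1 : deriv (fun t => ∫ s in α..t, k s) = k := funext fun t => (hSd t).deriv
  have e2 : deriv k = fun t => p.eval t := funext fun t => (hkd t).deriv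
  refine ⟨fun t => ∫ s in α..t, k s, ?_, fun t ht => ?_⟩
  · rw [contDiff_infty_iff_deriv, e1, contDiff_infty_iff_deriv, e2]
    exact ⟨fun t => (hSd t).differentiableAt, fun t => (hkd t).differentiableAt, by
      simpa using p.contDiff_aeval (𝕜 := ℝ) (⊤ : ℕ∞)⟩
  · have hle : ε / (β - α + 1) ≤ ε := div_le_self hε.le (by linarith)
    rw [e1, e2]
    refine ⟨?_, ((hp t ht).le).trans hle⟩
    have key := Convex.norm_image_sub_le_of_norm_hasDerivWithin_le (f := fun t => k t - f t)
      (fun u hu => ((hkd u).sub (hf u hu)).hasDerivWithinAt) (fun u hu => (hp u hu).le)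
      (convex_Icc α β) (Set.left_mem_Icc.2 hαβ) ht
    have e0 : k α - f α = 0 := by simp [hk]
    simp only [e0, sub_zero] at key
    refine key.trans ?_
    rw [Real.norm_of_nonneg (by linarith [ht.1]), div_mul_eq_mul_div, div_le_iff₀ hl]
    exact mul_le_mul_of_nonneg_left (by linarith [ht.2]) hε.le

/-- Smooth cutoff functions on the line with scaling bounds. -/
theorem exists_cutoff : ∃ C : ℝ, 0 < C ∧ ∀ (c l : ℝ), 0 < l → ∃ χ : ℝ → ℝ,
    ContDiff ℝ (⊤ : ℕ∞) χ ∧ (∀ t ∈ Set.Icc (c - l) (c + l), χ t = 1) ∧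
    (∀ t ∉ Set.Icc (c - 2 * l) (c + 2 * l), χ t = 0) ∧ (∀ t, |χ t| ≤ 1) ∧
    (∀ t, |deriv χ t| ≤ C / l) ∧ ∀ t, |deriv (deriv χ) t| ≤ C / l ^ 2 := by
  -- All cutoffs are rescalings of this single bump, so the constant does not depend on `c` or `l`.
  let b : ContDiffBump (0 : ℝ) := ⟨1, 2, one_pos, one_lt_two⟩
  have hb : ContDiff ℝ (⊤ : ℕ∞) b := b.contDiff
  have hb1 : ContDiff ℝ (⊤ : ℕ∞) (deriv b) := (contDiff_infty_iff_deriv.1 hb).2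
  have hb2 : ContDiff ℝ (⊤ : ℕ∞) (deriv (deriv b)) := (contDiff_infty_iff_deriv.1 hb1).2
  have s1 : HasCompactSupport (deriv b) := b.hasCompactSupport.deriv
  obtain ⟨C1, h1⟩ := hb1.continuous.bounded_above_of_compact_support s1
  obtain ⟨C2, h2⟩ := hb2.continuous.bounded_above_of_compact_support s1.deriv
  refine ⟨max 1 (max C1 C2), by positivity, fun c l hl => ⟨fun t => b ((t - c) / l), ?_⟩⟩
  have hlin : ∀ t, HasDerivAt (fun t => (t - c) / l) (1 / l) t := fun t =>
    ((hasDerivAt_id t).sub_const c).div_const l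
  have d1 : deriv (fun t => b ((t - c) / l)) = fun t => deriv b ((t - c) / l) * (1 / l) :=
    funext fun t => (((hb.differentiable (by simp)).differentiableAt.hasDerivAt).comp t
      (hlin t)).deriv
  have d2 : deriv (deriv (fun t => b ((t - c) / l))) =
      fun t => deriv (deriv b) ((t - c) / l) * (1 / l) * (1 / l) := by
    rw [d1]
    exact funext fun t => ((((hb1.differentiable (by simp)).differentiableAt.hasDerivAt).comp t
      (hlin t)).mul_const _).deriv
  refine ⟨hb.comp ((contDiff_id.sub contDiff_const).div_const l), fun t ht => ?_, fun t ht => ?_,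
    fun t => ?_, fun t => ?_, fun t => ?_⟩
  · refine b.one_of_mem_closedBall ?_
    rw [mem_closedBall_zero_iff, Real.norm_eq_abs, abs_le]
    exact ⟨by rw [le_div_iff₀ hl]; linarith [ht.1], by rw [div_le_iff₀ hl]; linarith [ht.2]⟩
  · refine b.zero_of_le_dist ?_
    by_contra hlt
    push Not at hlt
    change dist ((t - c) / l) 0 < 2 at hlt
    rw [dist_zero_right, Real.norm_eq_abs, abs_lt, lt_div_iff₀ hl, div_lt_iff₀ hl] at hlt
    exact ht ⟨by linarith [hlt.1], by linarith [hlt.2]⟩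
  · rw [abs_of_nonneg b.nonneg]
    exact b.le_one
  · rw [d1]
    simp only
    rw [abs_mul, abs_of_pos (show 0 < 1 / l by positivity), mul_one_div]
    exact div_le_div_of_nonneg_right
      ((h1 _).trans ((le_max_left _ _).trans (le_max_right _ _))) hl.le
  · rw [d2]
    simp only
    rw [mul_assoc, abs_mul, abs_of_pos (show 0 < 1 / l * (1 / l) by positivity),
      show 1 / l * (1 / l) = 1 / l ^ 2 by field_simp, mul_one_div]
    exact div_le_div_of_nonneg_right
      ((h2 _).trans ((le_max_right _ _).trans (le_max_right _ _))) (by positivity)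

/-! ### WKB wave packets -/

noncomputable section

/-- The wave packet `χ exp(iS)`. -/
def wavePacket (S χ : ℝ → ℝ) (t : ℝ) : ℂ := (χ t : ℂ) * Complex.exp (Complex.I * S t)

end

section

variable {S χ : ℝ → ℝ}

theorem contDiff_wavePacket (hS : ContDiff ℝ (⊤ : ℕ∞) S) (hχ : ContDiff ℝ (⊤ : ℕ∞) χ) :
    ContDiff ℝ (⊤ : ℕ∞) (wavePacket S χ) :=
  (Complex.ofRealCLM.contDiff.comp hχ).mul
    (contDiff_const.mul (Complex.ofRealCLM.contDiff.comp hS)).cexp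

theorem norm_cexp_I_mul_ofReal (t : ℝ) : ‖Complex.exp (Complex.I * t)‖ = 1 := by
  rw [mul_comm, Complex.norm_exp_ofReal_mul_I]

theorem hasDerivAt_ofReal_deriv {f : ℝ → ℝ} (hf : ContDiff ℝ (⊤ : ℕ∞) f) (t : ℝ) :
    HasDerivAt (fun t => (f t : ℂ)) ((deriv f t : ℝ) : ℂ) t :=
  ((hf.differentiable (by simp)) t).hasDerivAt.ofReal_comp

theorem hasDerivAt_phase (hS : ContDiff ℝ (⊤ : ℕ∞) S) (t : ℝ) :
    HasDerivAt (fun t => Complex.exp (Complex.I * S t))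
      (Complex.exp (Complex.I * S t) * (Complex.I * deriv S t)) t :=
  ((hasDerivAt_ofReal_deriv hS t).const_mul Complex.I).cexp

theorem deriv_wavePacket (hS : ContDiff ℝ (⊤ : ℕ∞) S) (hχ : ContDiff ℝ (⊤ : ℕ∞) χ) :
    deriv (wavePacket S χ) = fun t =>
      (deriv χ t + Complex.I * deriv S t * χ t) * Complex.exp (Complex.I * S t) := by
  funext t
  refine (((hasDerivAt_ofReal_deriv hχ t).mul (hasDerivAt_phase hS t)).congr_deriv ?_).deriv
  ring

/-- The last term `-S'²χ` is the leading one: it cancels `Aχ` when `S' ≈ √A`. Each remaining term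
carries a derivative of χ or a second derivative of `S`. -/
theorem deriv_deriv_wavePacket (hS : ContDiff ℝ (⊤ : ℕ∞) S) (hχ : ContDiff ℝ (⊤ : ℕ∞) χ) (t : ℝ) :
    deriv (deriv (wavePacket S χ)) t =
      (deriv (deriv χ) t + 2 * Complex.I * deriv S t * deriv χ t +
        Complex.I * deriv (deriv S) t * χ t - deriv S t ^ 2 * χ t) *
        Complex.exp (Complex.I * S t) := by
  rw [deriv_wavePacket hS hχ]
  have hS1 := (contDiff_infty_iff_deriv.1 hS).2
  have hχ1 := (contDiff_infty_iff_deriv.1 hχ).2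
  refine ((((hasDerivAt_ofReal_deriv hχ1 t).add
    (((hasDerivAt_ofReal_deriv hS1 t).const_mul Complex.I).mul
      (hasDerivAt_ofReal_deriv hχ t))).mul (hasDerivAt_phase hS t)).congr_deriv ?_).deriv
  simp only [Pi.add_apply, Pi.mul_apply]
  linear_combination (deriv S t ^ 2 * χ t * Complex.exp (Complex.I * S t) : ℂ) * Complex.I_sq

theorem norm_wavePacket (t : ℝ) : ‖wavePacket S χ t‖ = |χ t| := by
  rw [wavePacket, norm_mul, norm_cexp_I_mul_ofReal, mul_one, Complex.norm_real, Real.norm_eq_abs]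

/-- The approximate solution of `-f'' = A f`. -/
theorem norm_deriv_deriv_wavePacket_add_le (hS : ContDiff ℝ (⊤ : ℕ∞) S)
    (hχ : ContDiff ℝ (⊤ : ℕ∞) χ) (t E : ℝ) (h1 : |χ t| ≤ 1) :
    ‖deriv (deriv (wavePacket S χ)) t + (E : ℂ) * wavePacket S χ t‖ ≤
      |deriv (deriv χ) t| + 2 * |deriv S t| * |deriv χ t| + |deriv (deriv S) t| +
        |E - deriv S t ^ 2| := by
  have e : deriv (deriv (wavePacket S χ)) t + (E : ℂ) * wavePacket S χ t =
      (((deriv (deriv χ) t : ℝ) : ℂ) + Complex.I * ((2 * deriv S t * deriv χ t : ℝ) : ℂ) +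
        Complex.I * ((deriv (deriv S) t * χ t : ℝ) : ℂ) +
        (((E - deriv S t ^ 2) * χ t : ℝ) : ℂ)) *
        Complex.exp (Complex.I * S t) := by
    rw [deriv_deriv_wavePacket hS hχ, wavePacket]
    push_cast
    ring
  rw [e, norm_mul, norm_cexp_I_mul_ofReal, mul_one]
  refine ((norm_add_le _ _).trans (add_le_add_left norm_add₃_le _)).trans ?_
  simp only [norm_mul, Complex.norm_I, one_mul, Complex.norm_real, Real.norm_eq_abs, Nat.abs_ofNat]
  have := mul_le_of_le_one_right (abs_nonneg (deriv (deriv S) t)) h1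
  have := mul_le_of_le_one_right (abs_nonneg (E - deriv S t ^ 2)) h1
  linarith

end

/-- Approximate solutions of `-f'' = A f` on long intervals far out, with large derivative. -/
theorem exists_approximate_mode {A : ℝ → ℝ} (hA : ContDiffOn ℝ 1 A (Set.Ioi 0))
    (hA_top : Tendsto A atTop atTop) (hA' : Tendsto (fun u => |deriv A u| / A u) atTop (𝓝 0))
    {δ : ℝ} (hδ : 0 < δ) (hδ1 : δ ≤ 1 / 2) :
    ∃ L > 0, ∀ᶠ c in atTop, 0 < A c ∧
      (∀ t ∈ Set.Icc (c - 2 * L) (c + 2 * L), 0 < A t ∧ A t ≤ 2 * A c) ∧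
      ∃ f : ℝ → ℂ, ContDiff ℝ (⊤ : ℕ∞) f ∧ (∀ t, ‖f t‖ ≤ 1) ∧
        (∀ t ∉ Set.Icc (c - 2 * L) (c + 2 * L), f t = 0) ∧
        (∀ t ∈ Set.Icc (c - 2 * L) (c + 2 * L),
          ‖deriv (deriv f) t + (A t : ℂ) * f t‖ ≤ 20 * δ * √(A c)) ∧
        ∀ t ∈ Set.Icc (c - L) (c + L), √(A c) / 4 ≤ ‖deriv f t‖ := by
  obtain ⟨C, hC, hcut⟩ := exists_cutoff
  have hL0 : 0 < 1 + C / δ := by positivity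
  -- This gives `C / L ≤ δ`, and `L ≥ 1` then gives `C / L² ≤ δ`. The length depends on δ but not on
  -- the centre `c`, so slow variation applies with a fixed radius.
  set L := 1 + C / δ with hLdef
  have hL1 : 1 ≤ L := le_add_of_nonneg_right (by positivity)
  have hCL : C / L ≤ δ := by
    rw [div_le_iff₀ hL0, hLdef, mul_add, mul_div_cancel₀ _ hδ.ne']
    linarith
  have hCL2 : C / L ^ 2 ≤ δ := by
    refine le_trans ?_ hCL
    exact div_le_div_of_nonneg_left hC.le hL0 (by nlinarith)
  have hdiff : DifferentiableOn ℝ A (Set.Ioi 0) := hA.differentiableOn (by simp)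
  have hslow := eventually_slowly_varying hdiff (hA_top.eventually_gt_atTop 0)
    ((tendsto_zero_iff_abs_tendsto_zero _).2 (by
      refine hA'.congr' ?_
      filter_upwards [hA_top.eventually_gt_atTop 0] with u hu
      rw [Function.comp_apply, abs_div, abs_of_pos hu])) (2 * L) (by positivity)
  have hfar : ∀ᶠ u in atTop, 1 ≤ A u ∧ |deriv A u| / A u < δ ∧ 0 < u := by
    filter_upwards [hA_top.eventually_ge_atTop 1, hA'.eventually_lt_const hδ,
      eventually_gt_atTop 0] with u h1 h2 h3
    exact ⟨h1, h2, h3⟩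
  have h2 : Tendsto (fun c : ℝ => c - 2 * L) atTop atTop :=
    tendsto_atTop_add_const_right _ _ tendsto_id
  refine ⟨L, hL0, ?_⟩
  filter_upwards [hslow, h2.eventually (eventually_forall_ge_atTop.2 hfar)] with c hs hf
  have hAc : 1 ≤ A c := (hf c (by linarith)).1
  refine ⟨by linarith, fun t ht => ⟨by linarith [(hf t ht.1).1], (hs t ht).1⟩, ?_⟩
  have hder : ∀ t ∈ Set.Icc (c - 2 * L) (c + 2 * L),
      HasDerivAt (fun t => √(A t)) (deriv A t / (2 * √(A t))) t := fun t ht => by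
    obtain ⟨p1, -, p3⟩ := hf t ht.1
    exact ((hdiff.differentiableAt (Ioi_mem_nhds p3)).hasDerivAt).sqrt (by linarith)
  have hcont : ContinuousOn (fun t => deriv A t / (2 * √(A t)))
      (Set.Icc (c - 2 * L) (c + 2 * L)) := by
    have hsub : Set.Icc (c - 2 * L) (c + 2 * L) ⊆ Set.Ioi 0 := fun t ht => (hf t ht.1).2.2
    refine ((hA.continuousOn_deriv_of_isOpen isOpen_Ioi (by simp)).mono hsub).div
      (continuousOn_const.mul ((hA.continuousOn.mono hsub).sqrt)) fun t ht => ?_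
    have := (hf t ht.1).1
    positivity
  -- On the window `S'` is within δ of `√A`, and `S''` within δ of `(√A)' = A'/(2√A)`.
  obtain ⟨S, hS, hSa⟩ := exists_smooth_phase (by linarith) hder hcont hδ
  obtain ⟨χ, hχ, hχ1, hχ0, hχb, hχd, hχdd⟩ := hcut c L hL0
  have hbasic : ∀ t ∈ Set.Icc (c - 2 * L) (c + 2 * L),
      1 ≤ √(A t) ∧ √(A t) ≤ 2 * √(A c) ∧ √(A c) ≤ 2 * √(A t) := fun t ht => by
    have hAt := (hf t ht.1).1
    refine ⟨Real.one_le_sqrt.2 hAt, ?_, ?_⟩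
    · refine Real.sqrt_le_iff.2 ⟨by positivity, ?_⟩
      rw [mul_pow, Real.sq_sqrt (by linarith)]
      linarith [(hs t ht).1]
    · refine Real.sqrt_le_iff.2 ⟨by positivity, ?_⟩
      rw [mul_pow, Real.sq_sqrt (by linarith)]
      linarith [(hs t ht).2]
  refine ⟨wavePacket S χ, contDiff_wavePacket hS hχ, fun t => (norm_wavePacket t).trans_le (hχb t),
    fun t ht => ?_, fun t ht => ?_, fun t ht => ?_⟩
  · rw [wavePacket, hχ0 t ht, Complex.ofReal_zero, zero_mul]
  · obtain ⟨b1, b2, -⟩ := hbasic t ht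
    obtain ⟨k1, k2⟩ := hSa t ht
    have hAt := (hf t ht.1).1
    have hAd := (hf t ht.1).2.1
    have hsq : √(A t) ^ 2 = A t := Real.sq_sqrt (by linarith)
    refine (norm_deriv_deriv_wavePacket_add_le hS hχ t (A t) (hχb t)).trans ?_
    set r := √(A t)
    have c1 : |deriv A t / (2 * r)| ≤ δ * r := by
      rw [abs_div, abs_of_pos (show 0 < 2 * r by positivity), div_le_iff₀ (by positivity)]
      rw [div_lt_iff₀ (by linarith)] at hAd
      nlinarith
    have c2 : |deriv (deriv S) t| ≤ 2 * δ * r := by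
      have := abs_sub_abs_le_abs_sub (deriv (deriv S) t) (deriv A t / (2 * r))
      nlinarith
    have c3 : |deriv S t| ≤ 2 * r := by
      have := abs_sub_abs_le_abs_sub (deriv S t) r
      rw [abs_of_nonneg (show 0 ≤ r by linarith)] at this
      linarith
    have c4 : |A t - deriv S t ^ 2| ≤ 3 * δ * r := by
      rw [← hsq, sq_sub_sq, abs_mul]
      have e1 : |r - deriv S t| ≤ δ := by rwa [abs_sub_comm]
      have e2 : |r + deriv S t| ≤ 3 * r := (abs_add_le _ _).trans (by
        rw [abs_of_nonneg (show 0 ≤ r by linarith)]; linarith)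
      calc _ ≤ (3 * r) * δ := mul_le_mul e2 e1 (abs_nonneg _) (by positivity)
        _ = _ := by ring
    have c5 : |deriv (deriv χ) t| ≤ δ * r := ((hχdd t).trans hCL2).trans (by nlinarith)
    have c6 : 2 * |deriv S t| * |deriv χ t| ≤ 2 * (2 * r) * δ :=
      mul_le_mul (by linarith) ((hχd t).trans hCL) (abs_nonneg _) (by positivity)
    -- With `r = √(A t)` the four errors are at most `δr`, `4δr`, `2δr` and `3δr`; their sum `10δr`
    -- is bounded by `20δ√(A c)` because `r ≤ 2√(A c)`.
    nlinarith
  · have ht2 : t ∈ Set.Icc (c - 2 * L) (c + 2 * L) := ⟨by linarith [ht.1], by linarith [ht.2]⟩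
    obtain ⟨b1, -, b3⟩ := hbasic t ht2
    have k1 := (abs_le.1 (hSa t ht2).1).1
    rw [deriv_wavePacket hS hχ]
    simp only
    rw [norm_mul, norm_cexp_I_mul_ofReal, mul_one, hχ1 t ht]
    -- Once the unimodular factor is removed, `χ'` is real, so the imaginary part is `S'` on the
    -- plateau and nothing need be known about `χ'`. Then `S' ≥ √(A t) - 1/2 ≥ √(A t)/2 ≥ √(A c)/4`,
    -- using `√(A t) ≥ 1`.
    refine le_trans ?_ (Complex.abs_im_le_norm _)
    refine le_trans ?_ (le_abs_self _)
    simp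
    linarith

/-! ### Product functions and boxes -/

section

variable {d : ℕ}

/-- The box with centre `c` and half side lengths `l`. -/
def box (c l : Fin d → ℝ) : Set (EuclideanSpace ℝ (Fin d)) :=
  {x | ∀ i, x i ∈ Set.Icc (c i - l i) (c i + l i)}

theorem box_eq_preimage (c l : Fin d → ℝ) :
    box c l = (MeasurableEquiv.toLp 2 (Fin d → ℝ)).symm ⁻¹' Set.Icc (c - l) (c + l) := by
  ext x
  simp only [box, Set.mem_ofPred_eq, Set.mem_preimage, Set.mem_Icc, Pi.le_def, forall_and]
  rfl

theorem measurableSet_box (c l : Fin d → ℝ) : MeasurableSet (box c l) := by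
  rw [box_eq_preimage]
  exact (MeasurableEquiv.toLp 2 (Fin d → ℝ)).symm.measurable measurableSet_Icc

theorem volume_box (c l : Fin d → ℝ) : volume (box c l) = ∏ i, ENNReal.ofReal (2 * l i) := by
  rw [box_eq_preimage,
    (EuclideanSpace.volume_preserving_symm_measurableEquiv_toLp (Fin d)).measure_preimage
      measurableSet_Icc.nullMeasurableSet, Real.volume_Icc_pi]
  refine Finset.prod_congr rfl fun i _ => ?_
  congr 1
  simp only [Pi.add_apply, Pi.sub_apply]
  ring

/-- Lower bounds will hold on the plateau box and upper bounds on the doubled support box. The ratio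
of their volumes depends only on the dimension, so comparing them costs a fixed constant. -/
theorem volume_box_two_mul (c l : Fin d → ℝ) :
    volume (box c fun i => 2 * l i) = 2 ^ d * volume (box c l) := by
  rw [volume_box, volume_box]
  simp only [ENNReal.ofReal_mul zero_le_two, ENNReal.ofReal_ofNat]
  rw [Finset.prod_mul_distrib]
  simp

theorem isCompact_box (c l : Fin d → ℝ) : IsCompact (box c l) := by
  have h : box c l = (EuclideanSpace.equiv (Fin d) ℝ).symm '' Set.Icc (c - l) (c + l) := by
    rw [← ContinuousLinearEquiv.coe_toHomeomorph, Homeomorph.image_eq_preimage_symm]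
    exact box_eq_preimage c l
  rw [h]
  exact isCompact_Icc.image (ContinuousLinearEquiv.continuous _)

/-- The product `x ↦ ∏ᵢ fᵢ(xᵢ)`. -/
def prodFun (f : Fin d → ℝ → ℂ) (x : EuclideanSpace ℝ (Fin d)) : ℂ := ∏ i, f i (x i)

theorem prodFun_update (f : Fin d → ℝ → ℂ) (j : Fin d) (g : ℝ → ℂ)
    (x : EuclideanSpace ℝ (Fin d)) :
    prodFun (Function.update f j g) x = g (x j) * ∏ i ∈ Finset.univ.erase j, f i (x i) := by
  rw [prodFun, ← Finset.mul_prod_erase _ _ (Finset.mem_univ j), Function.update_self]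
  congr 1
  refine Finset.prod_congr rfl fun i hi => ?_
  rw [Function.update_of_ne (Finset.ne_of_mem_erase hi)]

theorem contDiff_prodFun {f : Fin d → ℝ → ℂ} (hf : ∀ i, ContDiff ℝ (⊤ : ℕ∞) (f i)) :
    ContDiff ℝ (⊤ : ℕ∞) (prodFun f) :=
  contDiff_prod fun i _ => (hf i).comp
    (EuclideanSpace.proj (𝕜 := ℝ) i : EuclideanSpace ℝ (Fin d) →L[ℝ] ℝ).contDiff

/-- Along the `j`-th coordinate line only the `j`-th factor moves. Keeping the derivative in product
form allows the formula to be iterated. -/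
theorem pderiv_prodFun {f : Fin d → ℝ → ℂ} (hf : ∀ i, ContDiff ℝ (⊤ : ℕ∞) (f i)) (j : Fin d) :
    pderiv j (prodFun f) = prodFun (Function.update f j (deriv (f j))) := by
  funext x
  have h1 : HasDerivAt (fun t : ℝ => prodFun f (x + t • EuclideanSpace.single j 1))
      (pderiv j (prodFun f) x) 0 := by
    have := (((contDiff_prodFun hf).differentiable (by simp)) x).hasFDerivAt.hasLineDerivAt
      (EuclideanSpace.single j 1)
    exact this
  have h2 : HasDerivAt (fun t : ℝ => prodFun f (x + t • EuclideanSpace.single j 1))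
      (prodFun (Function.update f j (deriv (f j))) x) 0 := by
    rw [prodFun_update]
    have e : (fun t : ℝ => prodFun f (x + t • EuclideanSpace.single j 1)) = fun t =>
        f j (x j + t) * ∏ i ∈ Finset.univ.erase j, f i (x i) := by
      funext t
      rw [prodFun, ← Finset.mul_prod_erase _ _ (Finset.mem_univ j)]
      congr 1
      · simp
      · refine Finset.prod_congr rfl fun i hi => ?_
        simp [Finset.ne_of_mem_erase hi]
    rw [e]
    refine HasDerivAt.mul_const ?_ _
    have h3 : HasDerivAt (f j) (deriv (f j) (x j + 0)) (x j + 0) :=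
      (((hf j).differentiable (by simp)) _).hasDerivAt
    have := h3.comp_const_add (x j) 0
    rwa [add_zero] at this
  exact h1.unique h2

theorem pderiv_pderiv_prodFun {f : Fin d → ℝ → ℂ} (hf : ∀ i, ContDiff ℝ (⊤ : ℕ∞) (f i))
    (j : Fin d) (x : EuclideanSpace ℝ (Fin d)) :
    pderiv j (pderiv j (prodFun f)) x =
      deriv (deriv (f j)) (x j) * ∏ i ∈ Finset.univ.erase j, f i (x i) := by
  have hf1 : ∀ i, ContDiff ℝ (⊤ : ℕ∞) (Function.update f j (deriv (f j)) i) := fun i => by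
    by_cases h : i = j
    · subst h
      rw [Function.update_self]
      exact (contDiff_infty_iff_deriv.1 (hf i)).2
    · rw [Function.update_of_ne h]
      exact hf i
  rw [pderiv_prodFun hf, pderiv_prodFun hf1, Function.update_idem, Function.update_self,
    prodFun_update]

theorem norm_prod_le_one {ι : Type*} (s : Finset ι) {f : ι → ℂ} (h : ∀ i, ‖f i‖ ≤ 1) :
    ‖∏ i ∈ s, f i‖ ≤ 1 := by
  rw [norm_prod]
  exact Finset.prod_le_one (fun _ _ => norm_nonneg _) fun i _ => h i

/-- If `f₀` is an approximate solution of `-f₀'' = A f₀` and the other factors are slowly varying,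
then the product is an approximate solution of `-Δ φ = A φ`. -/
theorem norm_lap_prodFun_add_le [NeZero d] {f : Fin d → ℝ → ℂ}
    (hf : ∀ i, ContDiff ℝ (⊤ : ℕ∞) (f i)) (hf1 : ∀ i t, ‖f i t‖ ≤ 1) {D : ℝ}
    (hD : ∀ i, i ≠ 0 → ∀ t, ‖deriv (deriv (f i)) t‖ ≤ D) (E : ℝ)
    (x : EuclideanSpace ℝ (Fin d)) :
    ‖lap (prodFun f) x + (E : ℂ) * prodFun f x‖ ≤
      ‖deriv (deriv (f 0)) (x 0) + (E : ℂ) * f 0 (x 0)‖ + ((d : ℝ) - 1) * D := by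
  have e : lap (prodFun f) x + (E : ℂ) * prodFun f x =
      (deriv (deriv (f 0)) (x 0) + (E : ℂ) * f 0 (x 0)) *
        (∏ i ∈ Finset.univ.erase 0, f i (x i)) +
      ∑ j ∈ Finset.univ.erase 0,
        deriv (deriv (f j)) (x j) * ∏ i ∈ Finset.univ.erase j, f i (x i) := by
    simp only [lap, pderiv_pderiv_prodFun hf]
    rw [← Finset.add_sum_erase _ _ (Finset.mem_univ (0 : Fin d)), prodFun,
      ← Finset.mul_prod_erase _ _ (Finset.mem_univ (0 : Fin d))]
    ring
  rw [e]
  refine (norm_add_le _ _).trans (add_le_add ?_ ?_)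
  · rw [norm_mul]
    exact mul_le_of_le_one_right (norm_nonneg _) (norm_prod_le_one _ fun i => hf1 i _)
  · have hcard : ((Finset.univ.erase (0 : Fin d)).card : ℝ) = (d : ℝ) - 1 := by
      rw [Finset.card_erase_of_mem (Finset.mem_univ _), Finset.card_univ, Fintype.card_fin,
        Nat.cast_sub (Nat.one_le_iff_ne_zero.2 (NeZero.ne d)), Nat.cast_one]
    rw [← hcard, ← nsmul_eq_mul]
    refine norm_sum_le_of_le _ (fun j _ => ?_) |>.trans (Finset.sum_const D).le
    rw [norm_mul]
    exact (mul_le_of_le_one_right (norm_nonneg _) (norm_prod_le_one _ fun i => hf1 i _)).trans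
      (hD j (Finset.ne_of_mem_erase ‹_›) _)

end

/-! ### Comparison of `L²` norms and the geometry of the tube -/

/-- Comparison of `L²` norms by pointwise bounds on sets of comparable measure. -/
theorem eLpNorm_two_le_of_pointwise {X F G : Type*} [MeasurableSpace X] {μ : Measure X}
    [NormedAddCommGroup F] [NormedAddCommGroup G] {E₁ E₂ : Set X} (h₁ : MeasurableSet E₁)
    (h₂ : MeasurableSet E₂) {d : ℕ} (hμ : μ E₂ ≤ 2 ^ d * μ E₁) (h0 : μ E₁ ≠ 0)
    {f : X → F} {g : X → G} {κ m ε : ℝ} (hm : 0 < m) (hε : 0 ≤ ε)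
    (hf : ∀ᵐ x ∂μ, x ∈ E₂ → ‖f x‖ ≤ κ) (hf0 : ∀ᵐ x ∂μ, x ∉ E₂ → f x = 0)
    (hg : ∀ x ∈ E₁, m ≤ ‖g x‖) (hκ : 2 ^ d * κ ≤ ε * m) :
    eLpNorm g 2 μ ≠ 0 ∧ eLpNorm f 2 μ ≤ ENNReal.ofReal ε * eLpNorm g 2 μ := by
  have hlow : ENNReal.ofReal m * μ E₁ ^ (1 / 2 : ℝ) ≤ eLpNorm g 2 μ := by
    have := eLpNorm_indicator_const (μ := μ) (c := m) h₁ (p := 2) (by norm_num) (by norm_num)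
    rw [Real.enorm_of_nonneg hm.le, ENNReal.toReal_ofNat] at this
    rw [← this]
    refine eLpNorm_mono fun x => ?_
    by_cases hx : x ∈ E₁
    · rw [Set.indicator_of_mem hx, Real.norm_of_nonneg hm.le]
      exact hg x hx
    · rw [Set.indicator_of_notMem hx, norm_zero]
      exact norm_nonneg _
  have hup : eLpNorm f 2 μ ≤ ENNReal.ofReal κ * μ E₂ ^ (1 / 2 : ℝ) := by
    -- The sign of `κ` is not prescribed, hence the truncation; `ENNReal.ofReal` removes it again.
    have := eLpNorm_indicator_const (μ := μ) (c := max κ 0) h₂ (p := 2) (by norm_num) (by norm_num)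
    rw [Real.enorm_of_nonneg (le_max_right _ _), ENNReal.toReal_ofNat] at this
    have e : ENNReal.ofReal (max κ 0) = ENNReal.ofReal κ := by
      rw [ENNReal.ofReal_max, ENNReal.ofReal_zero, max_eq_left zero_le]
    rw [← e, ← this]
    refine eLpNorm_mono_ae ?_
    filter_upwards [hf, hf0] with x h3 h4
    by_cases hx : x ∈ E₂
    · rw [Set.indicator_of_mem hx, Real.norm_of_nonneg (le_max_right _ _)]
      exact (h3 hx).trans (le_max_left _ _)
    · rw [h4 hx, norm_zero]
      exact norm_nonneg _
  refine ⟨fun h => ?_, ?_⟩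
  · rw [h, nonpos_iff_eq_zero, mul_eq_zero, ENNReal.ofReal_eq_zero, not_le.2 hm |> iff_false_intro,
      false_or, ENNReal.rpow_eq_zero_iff_of_pos (by norm_num)] at hlow
    exact h0 hlow
  -- The sharp factor would be `2^{d/2}`; bounding it by `2^d` avoids fractional powers in the
  -- constants.
  · have hpow : μ E₂ ^ (1 / 2 : ℝ) ≤ 2 ^ d * μ E₁ ^ (1 / 2 : ℝ) := by
      refine (ENNReal.rpow_le_rpow hμ (by norm_num)).trans ?_
      rw [ENNReal.mul_rpow_of_nonneg _ _ (by norm_num)]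
      refine mul_le_mul_left ?_ _
      exact (ENNReal.rpow_le_rpow_of_exponent_le (one_le_pow₀ one_le_two) (by norm_num)).trans_eq
        (ENNReal.rpow_one _)
    calc eLpNorm f 2 μ ≤ ENNReal.ofReal κ * (2 ^ d * μ E₁ ^ (1 / 2 : ℝ)) :=
          hup.trans (mul_le_mul_right hpow _)
      _ = ENNReal.ofReal (2 ^ d * κ) * μ E₁ ^ (1 / 2 : ℝ) := by
          rw [ENNReal.ofReal_mul (by positivity), ENNReal.ofReal_pow zero_le_two,
            ENNReal.ofReal_ofNat]
          ring
      _ ≤ ENNReal.ofReal (ε * m) * μ E₁ ^ (1 / 2 : ℝ) :=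
          mul_le_mul_left (ENNReal.ofReal_le_ofReal hκ) _
      _ = ENNReal.ofReal ε * (ENNReal.ofReal m * μ E₁ ^ (1 / 2 : ℝ)) := by
          rw [ENNReal.ofReal_mul hε, mul_assoc]
      _ ≤ _ := mul_le_mul_right hlow _

/-- Far out, the tube contains long cylinders whose width is large compared with `A^{-1/4}`. -/
theorem eventually_exists_width {d : ℕ} [NeZero d] {ω A : ℝ → ℝ} (hω : ∀ u, 0 < u → 0 < ω u)
    (hA_top : Tendsto A atTop atTop)
    (hω_reg : 1 < d → ContDiffOn ℝ 2 ω (Set.Ioi 0) ∧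
      (fun u => deriv ω u / ω u) =o[atTop] (fun _ => (1 : ℝ)) ∧
      (fun u => deriv (deriv ω) u / ω u ^ 3) =O[atTop] (fun _ => (1 : ℝ)) ∧
      (fun u => ω u ^ 4 / A u) =o[atTop] (fun _ => (1 : ℝ)))
    {L C δ : ℝ} (hL : 0 < L) (hC : 0 < C) (hδ : 0 < δ) :
    ∀ᶠ c in atTop, ∃ s > 0,
      (∀ x : EuclideanSpace ℝ (Fin d), x 0 ∈ Set.Icc (c - 2 * L) (c + 2 * L) →
        (∀ i, i ≠ 0 → |x i| ≤ 2 * s) → x ∈ tube ω) ∧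
      ((d : ℝ) - 1) * (C / s ^ 2) ≤ δ * √(A c) := by
  have hd0 : d ≠ 0 := NeZero.ne d
  rcases Nat.lt_or_ge 1 d with hd | hd
  · obtain ⟨h1, h2, -, h4⟩ := hω_reg hd
    rw [Asymptotics.isLittleO_one_iff] at h2 h4
    have hdR : (0 : ℝ) < d := by exact_mod_cast Nat.pos_of_ne_zero hd0
    have hslow := eventually_slowly_varying (h1.differentiableOn (by simp))
      (by filter_upwards [eventually_gt_atTop 0] with u hu using hω u hu) h2 (2 * L) (by positivity)
    -- With the half width `s = 1/(8dω(c))` one has `C/s² = 64Cd²ω(c)²`; `d - 1 ≤ d` supplies the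
    -- third power of `d`, and the square arises because the hypothesis controls `ω⁴/A`.
    have hη : 0 < (δ / (64 * C * d ^ 3)) ^ 2 := by positivity
    filter_upwards [hslow, h4.eventually_lt_const hη, hA_top.eventually_gt_atTop 0,
      eventually_gt_atTop (2 * L)] with c hs hc hAc hcL
    have hωc : 0 < ω c := hω c (by linarith)
    -- Coordinates bounded by `2s = 1/(4dω(c))` give `|x'| ≤ 1/(4ω(c))`. Since `ω(x₁) ≤ 2ω(c)` over
    -- the window, this is strictly less than `1/ω(x₁)`.
    refine ⟨1 / (8 * d * ω c), by positivity, fun x hx hxi => ?_, ?_⟩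
    · have hx0 : 0 < x 0 := by linarith [hx.1]
      refine ⟨hx0, ?_⟩
      have hωx := hω _ hx0
      have hsum : ∑ i ∈ Finset.univ.erase (0 : Fin d), x i ^ 2 ≤ (1 / (4 * ω c)) ^ 2 := by
        have hb : ∀ i ∈ Finset.univ.erase (0 : Fin d), x i ^ 2 ≤ (2 * (1 / (8 * d * ω c))) ^ 2 :=
          fun i hi => by
            rw [← sq_abs]
            exact pow_le_pow_left₀ (abs_nonneg _) (hxi i (Finset.ne_of_mem_erase hi)) 2
        refine (Finset.sum_le_card_nsmul _ _ _ hb).trans ?_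
        rw [nsmul_eq_mul]
        have hcard : ((Finset.univ.erase (0 : Fin d)).card : ℝ) ≤ d := by
          exact_mod_cast (Finset.card_le_univ _).trans_eq (Fintype.card_fin d)
        have hd1 : (1 : ℝ) ≤ d := by exact_mod_cast hd.le
        have e : (2 * (1 / (8 * d * ω c))) ^ 2 = (1 / (4 * ω c)) ^ 2 / (d : ℝ) ^ 2 := by
          field_simp
          norm_num
        rw [e, mul_div_assoc', div_le_iff₀ (by positivity), mul_comm]
        exact mul_le_mul_of_nonneg_left (hcard.trans (by nlinarith)) (by positivity)
      refine ((Real.sqrt_le_sqrt hsum).trans_eq (Real.sqrt_sq (by positivity))).trans_lt ?_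
      rw [← one_div, one_div_lt_one_div (by positivity) hωx]
      linarith [(hs _ hx).1]
    · have hle : ω c ^ 2 ≤ δ / (64 * C * d ^ 3) * √(A c) := by
        refine le_of_sq_le_sq ?_ (by positivity)
        rw [mul_pow, Real.sq_sqrt hAc.le, ← pow_mul]
        rw [div_lt_iff₀ hAc] at hc
        exact hc.le
      have e : C / (1 / (8 * d * ω c)) ^ 2 = 64 * C * d ^ 2 * ω c ^ 2 := by
        field_simp
        norm_num
      rw [e]
      calc ((d : ℝ) - 1) * (64 * C * d ^ 2 * ω c ^ 2) ≤ d * (64 * C * d ^ 2 * ω c ^ 2) :=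
            mul_le_mul_of_nonneg_right (by linarith) (by positivity)
        _ = 64 * C * d ^ 3 * ω c ^ 2 := by ring
        _ ≤ 64 * C * d ^ 3 * (δ / (64 * C * d ^ 3) * √(A c)) :=
            mul_le_mul_of_nonneg_left hle (by positivity)
        _ = δ * √(A c) := by field_simp
  · obtain rfl : d = 1 := by omega
    filter_upwards [eventually_gt_atTop (2 * L)] with c hcL
    -- For `d = 1` there are no transverse directions and the transverse error has factor zero, so
    -- any width serves.
    refine ⟨1, one_pos, fun x hx _ => ?_, ?_⟩
    · have hx0 : 0 < x 0 := by linarith [hx.1]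
      have he : Finset.univ.erase (0 : Fin 1) = ∅ :=
        Finset.eq_empty_of_forall_notMem fun i hi =>
          Finset.ne_of_mem_erase hi (Subsingleton.elim _ _)
      refine ⟨hx0, ?_⟩
      simpa [he] using hω _ hx0
    · simp only [Nat.cast_one, sub_self, zero_mul]
      positivity

/-- Smallness of `B` compared with `A^{1/2}` far out in the tube. -/
theorem exists_abs_le_of_tendsto_essSup {d : ℕ} [NeZero d] {ω A : ℝ → ℝ}
    {B : EuclideanSpace ℝ (Fin d) → ℝ}
    (hB : Tendsto (fun n : ℕ =>
        essSup (fun x : EuclideanSpace ℝ (Fin d) => ((|B x| ^ 2 / A (x 0) : ℝ) : EReal))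
          (volume.restrict (tube ω ∩ {x | (n : ℝ) < ‖x‖})))
      atTop (𝓝 0)) {δ : ℝ} (hδ : 0 < δ) :
    ∃ n : ℕ, ∀ᵐ x ∂volume.restrict (tube ω ∩ {x : EuclideanSpace ℝ (Fin d) | (n : ℝ) < ‖x‖}),
      0 < A (x 0) → |B x| ≤ δ * √(A (x 0)) := by
  -- The essential supremum controls `B²/A`, hence the squared tolerance; positivity of `A` is
  -- needed only to clear the denominator.
  have hpos : (0 : EReal) < ((δ ^ 2 : ℝ) : EReal) := by
    rw [EReal.coe_pos]
    positivity
  obtain ⟨n, hn⟩ := (hB.eventually_lt_const hpos).exists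
  refine ⟨n, ?_⟩
  filter_upwards [ae_lt_of_essSup_lt hn] with x hx hA
  rw [EReal.coe_lt_coe_iff, div_lt_iff₀ hA] at hx
  refine le_of_sq_le_sq ?_ (by positivity)
  rw [mul_pow, Real.sq_sqrt hA.le]
  exact hx.le

/-! ### Localized quasimodes in the tube -/

theorem lap_eq_zero_of_notMem {d : ℕ} {Ω : Opens (EuclideanSpace ℝ (Fin d))} {φ : 𝓓(Ω, ℂ)}
    {x : EuclideanSpace ℝ (Fin d)} (hx : x ∉ tsupport (⇑φ)) : lap (⇑φ) x = 0 :=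
  Finset.sum_eq_zero fun i _ => image_eq_zero_of_notMem_tsupport
    (f := pderiv i (pderiv i (⇑φ))) fun h => hx
      (tsupport_fderiv_apply_subset ℝ (EuclideanSpace.single i 1)
        (tsupport_fderiv_apply_subset ℝ (EuclideanSpace.single i 1) h))

/-- Localized approximate solutions of `Δ φ = (q + 2 λ a + λ²) φ` far out in the tube. -/
theorem exists_testFunction {d : ℕ} [NeZero d] {Ω : Opens (EuclideanSpace ℝ (Fin d))}
    {a q : EuclideanSpace ℝ (Fin d) → ℝ} {lam : ℝ} {ω : ℝ → ℝ} (hω : ∀ u, 0 < u → 0 < ω u)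
    (htube : tube ω ⊆ (Ω : Set (EuclideanSpace ℝ (Fin d))))
    {A : ℝ → ℝ} {B : EuclideanSpace ℝ (Fin d) → ℝ}
    (hdecomp : ∀ᵐ x ∂volume.restrict (tube ω : Set (EuclideanSpace ℝ (Fin d))),
      q x + 2 * lam * a x + lam ^ 2 = -A (x 0) + B x)
    (hA : ContDiffOn ℝ 1 A (Set.Ioi 0))
    (hA_top : Tendsto A atTop atTop)
    (hA' : Tendsto (fun u => |deriv A u| / A u) atTop (𝓝 0))
    (hB : Tendsto (fun n : ℕ =>
        essSup (fun x : EuclideanSpace ℝ (Fin d) => ((|B x| ^ 2 / A (x 0) : ℝ) : EReal))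
          (volume.restrict (tube ω ∩ {x | (n : ℝ) < ‖x‖})))
      atTop (𝓝 0))
    (hω_reg : 1 < d → ContDiffOn ℝ 2 ω (Set.Ioi 0) ∧
      (fun u => deriv ω u / ω u) =o[atTop] (fun _ => (1 : ℝ)) ∧
      (fun u => deriv (deriv ω) u / ω u ^ 3) =O[atTop] (fun _ => (1 : ℝ)) ∧
      (fun u => ω u ^ 4 / A u) =o[atTop] (fun _ => (1 : ℝ)))
    {ε : ℝ} (hε : 0 < ε) (hε1 : ε ≤ 1) (R : ℝ) :
    ∃ φ : 𝓓(Ω, ℂ), (∀ x : EuclideanSpace ℝ (Fin d), x 0 ≤ R → φ x = 0) ∧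
      eLpNorm (gradC (⇑φ)) 2 (volume.restrict (Ω : Set (EuclideanSpace ℝ (Fin d)))) ≠ 0 ∧
      eLpNorm (residual a q lam (⇑φ)) 2
          (volume.restrict (Ω : Set (EuclideanSpace ℝ (Fin d)))) ≤
        ENNReal.ofReal ε * eLpNorm (gradC (⇑φ)) 2
          (volume.restrict (Ω : Set (EuclideanSpace ℝ (Fin d)))) := by
  have h2d : (1 : ℝ) ≤ 2 ^ d := one_le_pow₀ one_le_two
  -- The number `92 = 23 · 4` combines the residual bound `23δ√(A c)` with the gradient bound `√(A
  -- c)/4`; `2^d` is the loss from comparing the two boxes.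
  obtain ⟨δ, hδ, hδε⟩ : ∃ δ : ℝ, 0 < δ ∧ 2 ^ d * (92 * δ) = ε :=
    ⟨ε / (2 ^ d * 92), by positivity, by field_simp⟩
  have hδ1 : δ ≤ 1 / 2 := by nlinarith
  obtain ⟨L, hL, hmode⟩ := exists_approximate_mode hA hA_top hA' hδ hδ1
  obtain ⟨C, hC, hcut⟩ := exists_cutoff
  obtain ⟨n, hn⟩ := exists_abs_le_of_tendsto_essSup hB hδ
  -- `L`, `C` and `n` are fixed before `c`, so all requirements hold for large `c` and can be met at
  -- once. The last two place the box where the bound on `B` holds and beyond `x₁ = R`.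
  obtain ⟨c, ⟨hAc, hAt, f₀, hf₀, hf₀b, hf₀0, hf₀r, hf₀d⟩, ⟨s, hs, hst, hsd⟩, hcn, hcR⟩ :=
    (hmode.and ((eventually_exists_width (d := d) hω hA_top hω_reg hL hC hδ).and
      ((eventually_gt_atTop (n + 2 * L)).and (eventually_gt_atTop (R + 2 * L))))).exists
  obtain ⟨χ, hχ, hχ1, hχ0, hχb, -, hχdd⟩ := hcut 0 s hs
  -- A packet with zero phase is the cutoff itself, viewed as complex valued, so the packet
  -- estimates also serve the transverse factors.
  set f : Fin d → ℝ → ℂ := fun i => if i = 0 then f₀ else wavePacket (fun _ => 0) χ with hf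
  have hfz : f 0 = f₀ := if_pos rfl
  have hfi : ∀ i, i ≠ 0 → f i = wavePacket (fun _ => 0) χ := fun i hi => if_neg hi
  have hfs : ∀ i, ContDiff ℝ (⊤ : ℕ∞) (f i) := fun i => by
    by_cases hi : i = 0
    · rw [hi, hfz]; exact hf₀
    · rw [hfi i hi]; exact contDiff_wavePacket contDiff_const hχ
  have hfb : ∀ i t, ‖f i t‖ ≤ 1 := fun i t => by
    by_cases hi : i = 0
    · rw [hi, hfz]; exact hf₀b t
    · rw [hfi i hi, norm_wavePacket]; exact hχb t
  have hfD : ∀ i, i ≠ 0 → ∀ t, ‖deriv (deriv (f i)) t‖ ≤ C / s ^ 2 := fun i hi t => by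
    rw [hfi i hi]
    have := norm_deriv_deriv_wavePacket_add_le (S := fun _ => (0 : ℝ)) contDiff_const hχ t 0 (hχb t)
    simp at this
    exact this.trans (hχdd t)
  set p : Fin d → ℝ := fun i => if i = 0 then c else 0 with hp
  set l : Fin d → ℝ := fun i => if i = 0 then L else s with hl
  have hl0 : ∀ i, 0 < l i := fun i => by
    by_cases hi : i = 0
    · rw [hl]; simpa [hi] using hL
    · rw [hl]; simpa [hi] using hs
  set Q₁ := box p l with hQ₁
  set Q₂ := box p (fun i => 2 * l i) with hQ₂
  have hQ₂z : ∀ x ∈ Q₂, x 0 ∈ Set.Icc (c - 2 * L) (c + 2 * L) := fun x hx => by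
    simpa [hp, hl] using hx 0
  have hQ₂t : Q₂ ⊆ tube ω := fun x hx => hst x (hQ₂z x hx) fun i hi => by
    have := hx i
    simp only [hp, hl, hi, if_false, zero_sub, zero_add] at this
    exact abs_le.2 this
  have hQ₁₂ : Q₁ ⊆ Q₂ := fun x hx i => by
    have h1 := hx i
    have h2 := hl0 i
    exact ⟨by linarith [h1.1], by linarith [h1.2]⟩
  have hsupp : ∀ x ∉ Q₂, prodFun f x = 0 := fun x hx => by
    simp only [hQ₂, box, Set.mem_ofPred_eq, not_forall] at hx
    obtain ⟨i, hi⟩ := hx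
    refine Finset.prod_eq_zero (Finset.mem_univ i) ?_
    by_cases h0 : i = 0
    · subst h0
      rw [hfz]
      exact hf₀0 _ (by simpa [hp, hl] using hi)
    · rw [hfi i h0, wavePacket, hχ0, Complex.ofReal_zero, zero_mul]
      simpa [hp, hl, h0] using hi
  have hts : tsupport (prodFun f) ⊆ Q₂ :=
    closure_minimal (fun x hx => by_contra fun h => hx (hsupp x h)) (isCompact_box _ _).isClosed
  let φ : 𝓓(Ω, ℂ) := ⟨prodFun f, contDiff_prodFun hfs,
    (isCompact_box _ _).of_isClosed_subset (isClosed_tsupport _) hts,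
    hts.trans (hQ₂t.trans htube)⟩
  have hφ : (⇑φ : EuclideanSpace ℝ (Fin d) → ℂ) = prodFun f := rfl
  refine ⟨φ, fun x hx => hsupp x fun h => ?_, ?_⟩
  · linarith [(hQ₂z x h).1]
  have hsqrt : 0 < √(A c) := Real.sqrt_pos.2 hAc
  have hvol : ∀ l', box p l' ⊆ Q₂ →
      (volume.restrict (Ω : Set (EuclideanSpace ℝ (Fin d)))) (box p l') = volume (box p l') :=
    fun l' h => by
      rw [Measure.restrict_apply (measurableSet_box _ _),
        Set.inter_eq_left.2 (h.trans (hQ₂t.trans htube))]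
  -- The constant is `23 = 20 + 1 + 2`: the longitudinal mode, the transverse cutoffs, and `B`,
  -- where `|B| ≤ δ√(A x₁) ≤ 2δ√(A c)`.
  refine eLpNorm_two_le_of_pointwise (measurableSet_box p l) (measurableSet_box p fun i => 2 * l i)
    (d := d) (κ := 23 * δ * √(A c)) (m := √(A c) / 4) ?_ ?_ (by positivity) hε.le ?_ ?_ ?_ ?_
  · rw [hvol _ hQ₁₂, hvol _ subset_rfl, volume_box_two_mul]
  · rw [hvol _ hQ₁₂, volume_box]
    exact Finset.prod_ne_zero_iff.2 fun i _ => by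
      rw [Ne, ENNReal.ofReal_eq_zero, not_le]
      linarith [hl0 i]
  · have hQn : Q₂ ⊆ tube ω ∩ {x | (n : ℝ) < ‖x‖} := fun x hx => ⟨hQ₂t hx, by
      have h1 := (hQ₂z x hx).1
      have h2 := PiLp.norm_apply_le x 0
      have h3 := Real.le_norm_self (x 0)
      change (n : ℝ) < ‖x‖
      linarith⟩
    -- Measurability of the tube is not available, so the almost everywhere statements are first
    -- restricted to the box, which is measurable, and only then turned into implications on the
    -- whole space.
    have k1 := ae_restrict_of_ae_restrict_of_subset hQ₂t hdecomp
    have k2 := ae_restrict_of_ae_restrict_of_subset hQn hn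
    rw [ae_restrict_iff' (measurableSet_box _ _)] at k1 k2
    filter_upwards [ae_restrict_of_ae k1, ae_restrict_of_ae k2] with x h1 h2 hx
    have h0 := hQ₂z x hx
    obtain ⟨hA1, hA2⟩ := hAt _ h0
    have hBx : |B x| ≤ 2 * δ * √(A c) := by
      refine (h2 hx hA1).trans ?_
      have : √(A (x 0)) ≤ 2 * √(A c) := by
        refine Real.sqrt_le_iff.2 ⟨by positivity, ?_⟩
        rw [mul_pow, Real.sq_sqrt hAc.le]
        linarith
      nlinarith
    have hlap := norm_lap_prodFun_add_le hfs hfb hfD (A (x 0)) x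
    rw [hfz] at hlap
    have e : residual a q lam (⇑φ) x =
        (lap (prodFun f) x + (A (x 0) : ℂ) * prodFun f x) - (B x : ℂ) * prodFun f x := by
      rw [residual, h1 hx, hφ]
      push_cast
      ring
    rw [e]
    refine (norm_sub_le _ _).trans ?_
    have hb : ‖(B x : ℂ) * prodFun f x‖ ≤ |B x| := by
      rw [norm_mul, Complex.norm_real, Real.norm_eq_abs]
      exact mul_le_of_le_one_right (abs_nonneg _) (norm_prod_le_one _ fun i => hfb i _)
    linarith [hf₀r _ h0]
  · refine ae_of_all _ fun x hx => ?_
    rw [residual, lap_eq_zero_of_notMem fun h => hx (hts h), hφ, hsupp x hx]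
    simp
  · intro x hx
    -- The first partial derivative suffices: on the inner box all transverse cutoffs equal 1, and
    -- it reduces to `f₀'`.
    refine le_trans ?_ (PiLp.norm_apply_le (gradC (⇑φ) x) 0)
    change _ ≤ ‖pderiv 0 (prodFun f) x‖
    rw [pderiv_prodFun hfs, prodFun_update, hfz, Finset.prod_eq_one, mul_one]
    · exact hf₀d _ (by simpa [hp, hl] using hx 0)
    · intro i hi
      have h0 := Finset.ne_of_mem_erase hi
      rw [hfi i h0, wavePacket, hχ1 _ (by simpa [hp, hl, h0] using hx i)]
      simp
  · rw [← hδε]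
    apply le_of_eq
    ring

end DampedWave

/-! ### Conclusion: tolerance `1/(n + 1)` and support beyond `x₁ = n` -/

theorem mainTheorem4 (d : ℕ) [NeZero d] (Ω : Opens (EuclideanSpace ℝ (Fin d)))
    (a q : EuclideanSpace ℝ (Fin d) → ℝ)
    (hreg : DampedWave.Regular Ω a q)
    (hq : DampedWave.LocLp Ω 2 q)
    (lam : ℝ) (hlam : lam < 0)
    (ω : ℝ → ℝ) (hω : ∀ u, 0 < u → 0 < ω u)
    (htube : DampedWave.tube ω ⊆ (Ω : Set (EuclideanSpace ℝ (Fin d))))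
    (A : ℝ → ℝ) (B : EuclideanSpace ℝ (Fin d) → ℝ)
    (hdecomp : ∀ᵐ x ∂volume.restrict (DampedWave.tube ω : Set (EuclideanSpace ℝ (Fin d))),
      q x + 2 * lam * a x + lam ^ 2 = -A (x 0) + B x)
    (hA : ContDiffOn ℝ 1 A (Set.Ioi 0))
    (hA_top : Tendsto A atTop atTop)
    (hA' : Tendsto (fun u => |deriv A u| / A u) atTop (𝓝 0))
    (hB : Tendsto (fun n : ℕ =>
        essSup (fun x : EuclideanSpace ℝ (Fin d) => ((|B x| ^ 2 / A (x 0) : ℝ) : EReal))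
          (volume.restrict (DampedWave.tube ω ∩ {x | (n : ℝ) < ‖x‖})))
      atTop (𝓝 0))
    (hω_reg : 1 < d → ContDiffOn ℝ 2 ω (Set.Ioi 0) ∧
      (fun u => deriv ω u / ω u) =o[atTop] (fun _ => (1 : ℝ)) ∧
      (fun u => deriv (deriv ω) u / ω u ^ 3) =O[atTop] (fun _ => (1 : ℝ)) ∧
      (fun u => ω u ^ 4 / A u) =o[atTop] (fun _ => (1 : ℝ))) :
    (lam : ℂ) ∈ DampedWave.essSpectrum2 (DampedWave.generator Ω a q) := by
  refine DampedWave.mem_essSpectrum2_of_testFunctions hreg.a_loc hq lam fun n => ?_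
  exact DampedWave.exists_testFunction hω htube hdecomp hA hA_top hA' hB hω_reg
    (by positivity) ((div_le_one (by positivity)).2 (by linarith [n.cast_nonneg (α := ℝ)])) n
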